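/- **Setting.** On a probability space, let $X=(X_t)_{t\ge1}$ be an arbitrary real Gaussian sequence with mean $m_t=\mathbb E X_t$ and covariance $K(t,s)=\mathbb E(X_t-m_t)(X_s-m_s)$. Let $\varepsilon=(\varepsilon_t)_{t\ge1}$ be i.i.d. $\mathcal N(0,1)$ and independent of $X$, let $(A_t)_{t\ge1}$ be real numbers, and let $Y_t=A_tX_t+\varepsilon_t$. Put $\mathcal Y_t=\sigma(Y_u,\ 1\le u\le t)$ (with $\mathcal Y_0$ trivial) and $\pi_{t}(\eta)=\mathbb E(\eta\mid\mathcal Y_t)$. Let $\mu\in\mathbb R$, $Q_t\ge0$ for $t\ge1$, and $S_t=A_t^2-\mu Q_t$. Fix $T\ge1$. **Condition $(C_\mu)$ (on the horizon $T$).** The equation $$\overline\gamma(t,s)=K(t,s)-\sum_{l=1}^{s-1}\overline\gamma(t,l)\,\overline\gamma(s,l)\,\frac{S_l}{1+S_l\overline\gamma_l},\qquad \overline\gamma_l=\overline\gamma(l,l),$$ has a unique and bounded solution on $\{1\le s\le t\le T\}$, and this solution satisfies $\overline\gamma_l\ge0$ and $1+S_l\overline\gamma_l>0$ for $1\le l\le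 T$. **Proposition (conditional Cameron–Martin formula).** Suppose that $(C_\mu)$ holds and let $\overline\gamma$ be the solution of the above equation. Let $h=(h_t)$ be any adapted process, i.e. $h_t$ is $\mathcal Y_t$-measurable for each $t$, and let $Z^h$ be the solution, for $1\le t\le T$, of $$Z^h_t=m_t-\sum_{l=1}^{t-1}\overline\gamma(t,l)\frac{\mu Q_l}{1+S_l\overline\gamma_l}(h_l-Z^h_l)+\sum_{l=1}^{t-1}\overline\gamma(t,l)\frac{A_l}{1+S_l\overline\gamma_l}(Y_l-A_lZ^h_l).$$ Then the random variable $$\mathcal I_T=\mathbb E\Big(\exp\Big\{\frac\mu2\sum_{s=1}^T(X_s-h_s)^2Q_s\Big\}\,\Big|\,\mathcal Y_T\Big)$$ (the conditional expectation of a positive random variable, a priori with values in $[0,\infty]$) satisfies, almost surely, $$\mathcal I_T=\left(\prod_{t=1}^T\Big[\frac{1+S_t\overline\gamma_t}{1+A_t^2\overline\gamma_t}\Big]^{-1/2}\exp\Big\{\frac\mu2Q_t\,\frac{1+A_t^2\overline\gamma_t}{1+S_t\overline\gamma_t}\Big[h_t-\frac{Z^h_t+A_t\overline\gamma_tY_t}{1+A_t^2\overline\gamma_t}\Big]^2\Big\}\right)\mathcal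 M_T .$$ In particular, $\mathcal I_T$ is almost surely finite. Here $$\mathcal M_t=\prod_{r=1}^t\Big[\frac{1+A_r^2\gamma_r}{1+A_r^2\overline\gamma_r}\Big]^{1/2}\exp\Big\{\frac{A_r}{1+A_r^2\overline\gamma_r}(Z^h_r-\pi_{r-1}(X_r))\nu_r-\frac12\,\frac{A_r^2}{1+A_r^2\overline\gamma_r}(Z^h_r-\pi_{r-1}(X_r))^2-\frac12\,\frac{A_r^2(\gamma_r-\overline\gamma_r)\nu_r^2}{(1+A_r^2\overline\gamma_r)(1+A_r^2\gamma_r)}\Big\}$$ for $0\le t\le T$ (with $\mathcal M_0=1$), where $\nu_t=Y_t-A_t\pi_{t-1}(X_t)$ are the innovations and $\gamma_t=\mathbb E(X_t-\pi_{t-1}(X_t))^2$ are the variances of the one-step prediction errors. The process $(\mathcal M_t)_{0\le t\le T}$ is a martingale with respect to $(\mathcal Y_t)_{0\le t\le T}$. -/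

import Mathlib

open MeasureTheory ProbabilityTheory
open scoped ENNReal

/-- The coefficient `S_l = A_l ^ 2 - μ Q_l`. -/
def coefS (A Q : ℕ → ℝ) (μ : ℝ) (l : ℕ) : ℝ := A l ^ 2 - μ * Q l

/-- `g` solves the Volterra-type equation
`g(t,s) = K(t,s) - ∑_{l=1}^{s-1} g(t,l) g(s,l) S_l / (1 + S_l g(l,l))` on `1 ≤ s ≤ t ≤ T`. -/
def IsGammaBarSolution (K : ℕ → ℕ → ℝ) (A Q : ℕ → ℝ) (μ : ℝ) (T : ℕ) (g : ℕ → ℕ → ℝ) : Prop :=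
  ∀ s t : ℕ, 1 ≤ s → s ≤ t → t ≤ T →
    g t s = K t s - ∑ l ∈ Finset.Icc 1 (s - 1),
      g t l * g s l * (coefS A Q μ l / (1 + coefS A Q μ l * g l l))

/-- The condition `(C_μ)` with horizon `T`: the equation has a solution on `1 ≤ s ≤ t ≤ T`, which
is unique and bounded there, with nonnegative diagonal `g(l,l)` and with `1 + S_l g(l,l) > 0`. -/
def ConditionC (K : ℕ → ℕ → ℝ) (A Q : ℕ → ℝ) (μ : ℝ) (T : ℕ) : Prop :=
  ∃ g : ℕ → ℕ → ℝ, IsGammaBarSolution K A Q μ T g ∧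
    (∀ g' : ℕ → ℕ → ℝ, IsGammaBarSolution K A Q μ T g' →
      ∀ s t : ℕ, 1 ≤ s → s ≤ t → t ≤ T → g' t s = g t s) ∧
    (∃ C : ℝ, ∀ s t : ℕ, 1 ≤ s → s ≤ t → t ≤ T → |g t s| ≤ C) ∧
    ∀ l : ℕ, 1 ≤ l → l ≤ T → 0 ≤ g l l ∧ 0 < 1 + coefS A Q μ l * g l l

section Processes

variable {Ω : Type*} [mΩ : MeasurableSpace Ω]

/-- The signal-observation model: `X = (X_t)_{t ≥ 1}` is a Gaussian sequence with mean `m` and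
covariance `K`, `ε = (ε_t)_{t ≥ 1}` is i.i.d. `N(0,1)` and independent of `X`, and
`Y_t = A_t X_t + ε_t`. Values at the index `0` play no role. -/
structure IsSignalObservationModel (P : Measure Ω) (m : ℕ → ℝ) (K : ℕ → ℕ → ℝ) (A : ℕ → ℝ)
    (X ε Y : ℕ → Ω → ℝ) : Prop where
  measurable_signal : ∀ t, 1 ≤ t → Measurable (X t)
  measurable_noise : ∀ t, 1 ≤ t → Measurable (ε t)
  gaussian_signal : IsGaussianProcess (fun t : {t : ℕ // 1 ≤ t} => X t) P
  mean_signal : ∀ t, 1 ≤ t → ∫ ω, X t ω ∂P = m t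
  cov_signal : ∀ t s, 1 ≤ t → 1 ≤ s → ∫ ω, (X t ω - m t) * (X s ω - m s) ∂P = K t s
  law_noise : ∀ t, 1 ≤ t → HasLaw (ε t) (gaussianReal 0 1) P
  indep_noise : iIndepFun (fun t : {t : ℕ // 1 ≤ t} => ε t) P
  indep_signal_noise : IndepFun (fun ω (t : {t : ℕ // 1 ≤ t}) => X t ω)
    (fun ω (t : {t : ℕ // 1 ≤ t}) => ε t ω) P
  observation : ∀ t, 1 ≤ t → ∀ ω, Y t ω = A t * X t ω + ε t ω

/-- The `σ`-algebra `𝒴_t = σ(Y_u, 1 ≤ u ≤ t)` (so `𝒴_0` is trivial). -/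
@[reducible] def obsSigma (Y : ℕ → Ω → ℝ) (t : ℕ) : MeasurableSpace Ω :=
  ⨆ u ∈ Set.Icc 1 t, MeasurableSpace.comap (Y u) inferInstance

/-- The natural filtration `(𝒴_t)` of the observation process. -/
def obsFiltration (Y : ℕ → Ω → ℝ) (hY : ∀ t, 1 ≤ t → Measurable (Y t)) : Filtration ℕ mΩ where
  seq := obsSigma Y
  mono' := fun _ _ hst => biSup_mono fun _ hu => ⟨hu.1, hu.2.trans hst⟩
  le' := fun _ => iSup₂_le fun u hu => (hY u hu.1).comap_le

theorem IsSignalObservationModel.measurable_obs {P : Measure Ω} {m : ℕ → ℝ} {K : ℕ → ℕ → ℝ}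
    {A : ℕ → ℝ} {X ε Y : ℕ → Ω → ℝ} (hM : IsSignalObservationModel P m K A X ε Y) :
    ∀ t, 1 ≤ t → Measurable (Y t) := by
  intro t ht
  have h : Y t = fun ω => A t * X t ω + ε t ω := funext (hM.observation t ht)
  rw [h]
  exact ((hM.measurable_signal t ht).const_mul _).add (hM.measurable_noise t ht)

/-- `Z` solves, for `1 ≤ t ≤ T`, the equation
`Z_t = m_t - ∑_{l=1}^{t-1} g(t,l) (μ Q_l / (1 + S_l g(l,l))) (h_l - Z_l)
  + ∑_{l=1}^{t-1} g(t,l) (A_l / (1 + S_l g(l,l))) (Y_l - A_l Z_l)`. -/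
def IsZSolution (m A Q : ℕ → ℝ) (μ : ℝ) (T : ℕ) (g : ℕ → ℕ → ℝ) (h Y Z : ℕ → Ω → ℝ) : Prop :=
  ∀ t : ℕ, 1 ≤ t → t ≤ T → ∀ ω,
    Z t ω = m t
      - ∑ l ∈ Finset.Icc 1 (t - 1),
          g t l * (μ * Q l / (1 + coefS A Q μ l * g l l)) * (h l ω - Z l ω)
      + ∑ l ∈ Finset.Icc 1 (t - 1),
          g t l * (A l / (1 + coefS A Q μ l * g l l)) * (Y l ω - A l * Z l ω)

/-- The one-step prediction `π_{t-1}(X_t) = E(X_t | 𝒴_{t-1})`. -/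
noncomputable def predictor (P : Measure Ω) (X Y : ℕ → Ω → ℝ) (t : ℕ) : Ω → ℝ :=
  P[X t | obsSigma Y (t - 1)]

/-- The innovation `ν_t = Y_t - A_t π_{t-1}(X_t)`. -/
noncomputable def innovation (P : Measure Ω) (A : ℕ → ℝ) (X Y : ℕ → Ω → ℝ) (t : ℕ) (ω : Ω) : ℝ :=
  Y t ω - A t * predictor P X Y t ω

/-- The variance `γ_t = E (X_t - π_{t-1}(X_t))^2` of the one-step prediction error. -/
noncomputable def predVar (P : Measure Ω) (X Y : ℕ → Ω → ℝ) (t : ℕ) : ℝ :=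
  ∫ ω, (X t ω - predictor P X Y t ω) ^ 2 ∂P

/-- The process `ℳ_T`. -/
noncomputable def cmMartingale (P : Measure Ω) (A : ℕ → ℝ) (g : ℕ → ℕ → ℝ) (X Y Z : ℕ → Ω → ℝ)
    (T : ℕ) (ω : Ω) : ℝ :=
  ∏ t ∈ Finset.Icc 1 T,
    (((1 + A t ^ 2 * predVar P X Y t) / (1 + A t ^ 2 * g t t)) ^ (1 / 2 : ℝ) *
      Real.exp
        (A t / (1 + A t ^ 2 * g t t) * (Z t ω - predictor P X Y t ω) * innovation P A X Y t ω
          - 1 / 2 * (A t ^ 2 / (1 + A t ^ 2 * g t t)) * (Z t ω - predictor P X Y t ω) ^ 2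
          - 1 / 2 * (A t ^ 2 * (predVar P X Y t - g t t) * innovation P A X Y t ω ^ 2 /
              ((1 + A t ^ 2 * g t t) * (1 + A t ^ 2 * predVar P X Y t)))))

/-- The random variable `exp{(μ/2) ∑_{s=1}^T (X_s - h_s)^2 Q_s}`. -/
noncomputable def expCost (Q : ℕ → ℝ) (μ : ℝ) (X h : ℕ → Ω → ℝ) (T : ℕ) (ω : Ω) : ℝ :=
  Real.exp (μ / 2 * ∑ s ∈ Finset.Icc 1 T, (X s ω - h s ω) ^ 2 * Q s)

/-- The explicit right-hand side of the representation of `ℐ_T`. -/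
noncomputable def cmRhs (P : Measure Ω) (A Q : ℕ → ℝ) (μ : ℝ) (g : ℕ → ℕ → ℝ)
    (X Y h Z : ℕ → Ω → ℝ) (T : ℕ) (ω : Ω) : ℝ :=
  (∏ t ∈ Finset.Icc 1 T,
    (((1 + coefS A Q μ t * g t t) / (1 + A t ^ 2 * g t t)) ^ (-1 / 2 : ℝ) *
      Real.exp
        (μ / 2 * Q t * ((1 + A t ^ 2 * g t t) / (1 + coefS A Q μ t * g t t)) *
          (h t ω - (Z t ω + A t * g t t * Y t ω) / (1 + A t ^ 2 * g t t)) ^ 2))) *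
    cmMartingale P A g X Y Z T ω

end Processes

/-! By Bayes' formula the observations `Y` may be replaced by white noise `e` independent of the
signal, at the price of the likelihood `∏ exp (A_l y_l x_l - A_l² x_l² / 2)`. The cost `exp (μ Q_l
(x_l - h_l)² / 2)` is also the exponential of a quadratic polynomial in `x_l`, so likelihood times
cost is, up to `exp (μ Q_l h_l² / 2)`, the weight `exp (-S_l x_l² / 2 + b_l x_l)` with `b_l = A_l
y_l - μ Q_l h_l`. Both the numerator and the denominator of the conditional expectation are thus
integrals of a Gaussian sequence against a product of such weights.

Such an integral is computed one coordinate at a time (`IsCenteredGaussian.lintegral_tilt`,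
`IsCenteredGaussian.lintegral_prod_tilt`). A weight in coordinate `i` gives a scalar mass
`tiltConst` and leaves a Gaussian process with a new mean and a new covariance. With weights `S_l,
b_l` the successive covariances solve the equation for `γbar` and the successive means solve the
equation for `Z`. With `S_l = A_l²`, `b_l = A_l y_l` they are the Kalman prediction variances and
predictors.

The value sought is therefore a ratio of two products of `tiltConst`. It splits, factor by factor,
through the intermediate constant `tiltConst (A²) (A y) Z γbar`: `costFactor_mul_tiltConst` gives
the explicit prefactor and `martFactor_mul_tiltConst` the factors of the martingale. That
intermediate constant is the likelihood ratio of `N(A Z, 1 + A² γbar)` against `N(0,1)`. It has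
integral one in the newest observation, while `Z` depends on earlier observations only; this is the
martingale property (`lintegral_martFun_succ`). -/

/-! ### Exponential-quadratic change of measure in one coordinate of a Gaussian process. -/

section GaussianTilt

open scoped NNReal

/-- The exponential-quadratic weight `exp (-S x² / 2 + b x)`. -/
noncomputable def tiltWeight (S b x : ℝ) : ℝ := Real.exp (-(S / 2) * x ^ 2 + b * x)

/-- The integral of `tiltWeight S b` against the Gaussian law with mean `z` and variance `v`. -/
noncomputable def tiltConst (S b z v : ℝ) : ℝ :=
  (√(1 + S * v))⁻¹ * Real.exp ((-(S / 2) * z ^ 2 + b * z + b ^ 2 * v / 2) / (1 + S * v))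

theorem tiltConst_nonneg (S b z v : ℝ) : 0 ≤ tiltConst S b z v := by
  unfold tiltConst; positivity

theorem gaussianPDFReal_mul_tiltWeight {v : ℝ≥0} (hv : v ≠ 0) {S : ℝ} (h : 0 < 1 + S * v)
    (b z x : ℝ) :
    gaussianPDFReal z v x * tiltWeight S b x = tiltConst S b z v *
      gaussianPDFReal (z + v * ((b - S * z) / (1 + S * v))) (v / (1 + S * v).toNNReal) x := by
  have hv' : (0 : ℝ) < v := by positivity
  have hd : (1 + S * v : ℝ) ≠ 0 := h.ne'
  simp only [gaussianPDFReal, tiltWeight, tiltConst, NNReal.coe_div, Real.coe_toNNReal _ h.le]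
  have hs : (√(2 * Real.pi * v))⁻¹ = (√(1 + S * v))⁻¹ * (√(2 * Real.pi * (v / (1 + S * v))))⁻¹ := by
    rw [← mul_inv, ← Real.sqrt_mul h.le]
    congr 2
    rw [mul_div_assoc', mul_div_cancel₀ _ hd]
  rw [hs]
  have e : ∀ a b c d e f : ℝ, d + e = f + c → a * b * Real.exp d * Real.exp e
      = a * Real.exp f * (b * Real.exp c) := by
    intro a b c d e f hf
    rw [mul_assoc, ← Real.exp_add, hf, Real.exp_add]; ring
  apply e
  -- Eliminating `S` in favour of `d = 1 + S v` leaves only the nonzero denominators `d` and `v`.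
  obtain ⟨d, hdS⟩ : ∃ d, d = 1 + S * (v : ℝ) := ⟨_, rfl⟩
  have hS : S = (d - 1) / v := by rw [hdS]; field_simp; ring
  rw [← hdS] at hd ⊢
  rw [hS]
  field_simp
  ring

/-- Completing the square turns the tilted density into a multiple of another Gaussian density.
Writing the tilted law as an affine image of the same `N(0, v)` covers `v = 0` and lets one process
serve on both sides later. -/
theorem lintegral_tilt_gaussianReal {v : ℝ≥0} {S : ℝ} (h : 0 < 1 + S * v) (b z : ℝ)
    {f : ℝ → ℝ≥0∞} (hf : Measurable f) :
    ∫⁻ x, f (z + x) * ENNReal.ofReal (tiltWeight S b (z + x)) ∂gaussianReal 0 v =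
      ENNReal.ofReal (tiltConst S b z v) *
        ∫⁻ x, f (z + v * ((b - S * z) / (1 + S * v)) + x / √(1 + S * v)) ∂gaussianReal 0 v := by
  have hw : Measurable fun x => ENNReal.ofReal (tiltWeight S b x) := by
    unfold tiltWeight; fun_prop
  rcases eq_or_ne v 0 with rfl | hv
  · simp only [gaussianReal_zero_var, lintegral_dirac]
    simp [tiltWeight, tiltConst, mul_comm]
  have h1 : ∫⁻ x, f (z + x) * ENNReal.ofReal (tiltWeight S b (z + x)) ∂gaussianReal 0 v
      = ∫⁻ x, f x * ENNReal.ofReal (tiltWeight S b x) ∂gaussianReal z v := by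
    have := gaussianReal_map_const_add (μ := 0) (v := v) z
    rw [zero_add] at this
    rw [← this]
    exact (lintegral_map (hf.mul hw) (by fun_prop)).symm
  set z' := z + v * ((b - S * z) / (1 + S * v)) with hz'
  have h2 : ∫⁻ x, f (z' + x / √(1 + S * v)) ∂gaussianReal 0 v
      = ∫⁻ x, f x ∂gaussianReal z' (v / (1 + S * v).toNNReal) := by
    have e1 := gaussianReal_map_div_const (μ := 0) (v := v) (√(1 + S * v))
    have e2 := gaussianReal_map_const_add (μ := 0) (v := v / (1 + S * v).toNNReal) z'
    have e3 : NNReal.mk (√(1 + S * v) ^ 2) (sq_nonneg _) = (1 + S * v).toNNReal := by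
      ext; simp [Real.sq_sqrt h.le, h.le]
    rw [zero_add] at e2
    rw [zero_div] at e1
    rw [← e2, lintegral_map hf (by fun_prop), ← e3, ← e1, lintegral_map (by fun_prop) (by fun_prop)]
  have hv2 : v / (1 + S * v).toNNReal ≠ 0 := by
    have : (1 + S * v).toNNReal ≠ 0 := by simpa using h
    positivity
  rw [h1, h2, gaussianReal_of_var_ne_zero _ hv, gaussianReal_of_var_ne_zero _ hv2,
    lintegral_withDensity_eq_lintegral_mul _ (measurable_gaussianPDF _ _) hf]
  refine (lintegral_withDensity_eq_lintegral_mul _ (measurable_gaussianPDF _ _)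
    (hf.mul hw)).trans ?_
  rw [← lintegral_const_mul _ ((measurable_gaussianPDF _ _).mul hf)]
  refine lintegral_congr fun x => ?_
  simp only [Pi.mul_apply, gaussianPDF]
  rw [mul_left_comm, ← ENNReal.ofReal_mul (gaussianPDFReal_nonneg _ _ _),
    gaussianPDFReal_mul_tiltWeight hv h, ENNReal.ofReal_mul (tiltConst_nonneg _ _ _ _), ← hz']
  ring

variable {Ω : Type*} {mΩ : MeasurableSpace Ω} {P : Measure Ω}

theorem ProbabilityTheory.IndepFun.lintegral_comp_prodMk {α β : Type*} [MeasurableSpace α]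
    [MeasurableSpace β] [IsFiniteMeasure P] {U : Ω → α} {V : Ω → β} (hUV : IndepFun U V P)
    (hU : Measurable U) (hV : Measurable V) {Φ : α → β → ℝ≥0∞}
    (hΦ : Measurable (Function.uncurry Φ)) :
    ∫⁻ ω, Φ (U ω) (V ω) ∂P = ∫⁻ ω, ∫⁻ ω', Φ (U ω) (V ω') ∂P ∂P := by
  have h1 : ∫⁻ ω, Φ (U ω) (V ω) ∂P
      = ∫⁻ p, Function.uncurry Φ p ∂(P.map fun ω => (U ω, V ω)) := by
    rw [lintegral_map hΦ (hU.prodMk hV)]; rfl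
  rw [h1, (indepFun_iff_map_prod_eq_prod_map_map hU.aemeasurable hV.aemeasurable).1 hUV,
    lintegral_prod _ hΦ.aemeasurable, lintegral_map (Measurable.lintegral_prod_right' hΦ) hU]
  refine lintegral_congr fun ω => ?_
  rw [lintegral_map (by fun_prop) hV]
  rfl

theorem ProbabilityTheory.IsGaussianProcess.linear_combination {ι κ : Type*} {W : ι → Ω → ℝ}
    (hW : IsGaussianProcess W P) (f g : κ → ι) (a c : κ → ℝ) :
    IsGaussianProcess (fun s ω => a s * W (f s) ω + c s * W (g s) ω) P := by
  classical
  refine hW.of_isGaussianProcess fun s => ⟨{f s, g s},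
    a s • ContinuousLinearMap.proj (⟨f s, by simp⟩ : ({f s, g s} : Finset ι)) +
      c s • ContinuousLinearMap.proj (⟨g s, by simp⟩ : ({f s, g s} : Finset ι)), fun ω => ?_⟩
  simp

/-- `W` is a centered Gaussian process with covariance function `κ`. -/
structure IsCenteredGaussian {ι : Type*} (P : Measure Ω) (κ : ι → ι → ℝ) (W : ι → Ω → ℝ) :
    Prop where
  measurable : ∀ t, Measurable (W t)
  gaussian : IsGaussianProcess W P
  integral_eq_zero : ∀ t, ∫ ω, W t ω ∂P = 0
  covariance_eq : ∀ t s, cov[W t, W s; P] = κ t s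

namespace IsCenteredGaussian

variable {ι : Type*} {κ : ι → ι → ℝ} {W : ι → Ω → ℝ}

theorem memLp_two (hW : IsCenteredGaussian P κ W) (t : ι) : MemLp (W t) 2 P :=
  (hW.gaussian.hasGaussianLaw_eval t).memLp_two

theorem variance_eq (hW : IsCenteredGaussian P κ W) (t : ι) : Var[W t; P] = κ t t := by
  rw [← hW.covariance_eq, covariance_self (hW.measurable t).aemeasurable]

theorem var_nonneg (hW : IsCenteredGaussian P κ W) (t : ι) : 0 ≤ κ t t := by
  rw [← hW.variance_eq]; exact variance_nonneg _ _

theorem map_eq (hW : IsCenteredGaussian P κ W) (t : ι) :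
    P.map (W t) = gaussianReal 0 (κ t t).toNNReal := by
  rw [(hW.gaussian.hasGaussianLaw_eval t).map_eq_gaussianReal, hW.integral_eq_zero,
    hW.variance_eq]

/-- A centered variable of variance zero vanishes almost surely. The regression coefficients `κ t i
/ κ i i` used below are then `0 / 0 = 0`, which is the correct value. -/
theorem cov_eq_zero_of_var_eq_zero (hW : IsCenteredGaussian P κ W) {i : ι} (hi : κ i i = 0)
    (t : ι) : κ t i = 0 := by
  have := hW.gaussian.isProbabilityMeasure
  have h0 : W i =ᵐ[P] 0 := by
    have := (evariance_eq_zero_iff (hW.measurable i).aemeasurable).1 (by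
      rw [← (hW.memLp_two i).ofReal_variance_eq, hW.variance_eq i, hi, ENNReal.ofReal_zero])
    filter_upwards [this] with ω hω
    simpa [hW.integral_eq_zero] using hω
  rw [← hW.covariance_eq, covariance_eq_sub (hW.memLp_two t) (hW.memLp_two i),
    hW.integral_eq_zero i, mul_zero, sub_zero]
  refine integral_eq_zero_of_ae ?_
  filter_upwards [h0] with ω hω
  simp [hω]

theorem covariance_linear_combination (hW : IsCenteredGaussian P κ W) (a b c d : ℝ)
    (t i s j : ι) :
    cov[fun ω => a * W t ω + b * W i ω, fun ω => c * W s ω + d * W j ω; P] =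
      a * c * κ t s + a * d * κ t j + b * c * κ i s + b * d * κ i j := by
  have := hW.gaussian.isProbabilityMeasure
  have hm : ∀ (a : ℝ) t, MemLp (fun ω => a * W t ω) 2 P := fun a t => (hW.memLp_two t).const_mul a
  have e1 : (fun ω => a * W t ω + b * W i ω) = (fun ω => a * W t ω) + fun ω => b * W i ω := rfl
  have e2 : (fun ω => c * W s ω + d * W j ω) = (fun ω => c * W s ω) + fun ω => d * W j ω := rfl
  rw [e1, e2, covariance_add_left (hm _ _) (hm _ _) ((hm _ _).add (hm _ _)),
    covariance_add_right (hm _ _) (hm _ _) (hm _ _),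
    covariance_add_right (hm _ _) (hm _ _) (hm _ _)]
  simp only [covariance_const_mul_left, covariance_const_mul_right, hW.covariance_eq]
  ring

/-- The image of a centered Gaussian process under the rescaling of its `i`-th coordinate along
the regression direction that realises an exponential-quadratic change of measure. -/
theorem rescale (hW : IsCenteredGaussian P κ W) (i : ι) {S : ℝ} (h : 0 < 1 + S * κ i i) :
    IsCenteredGaussian P (fun t s => κ t s - κ t i * κ s i * (S / (1 + S * κ i i)))
      (fun t ω => W t ω + κ t i / κ i i * ((√(1 + S * κ i i))⁻¹ - 1) * W i ω) where
  measurable t := (hW.measurable t).add ((hW.measurable i).const_mul _)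
  gaussian := by
    simpa using hW.gaussian.linear_combination id (fun _ => i) (fun _ => 1)
      (fun t => κ t i / κ i i * ((√(1 + S * κ i i))⁻¹ - 1))
  integral_eq_zero t := by
    rw [integral_add, integral_const_mul, hW.integral_eq_zero, hW.integral_eq_zero]
    · simp
    · exact (hW.gaussian.hasGaussianLaw_eval t).integrable
    · exact (hW.gaussian.hasGaussianLaw_eval i).integrable.const_mul _
  covariance_eq t s := by
    have e := hW.covariance_linear_combination 1 (κ t i / κ i i * ((√(1 + S * κ i i))⁻¹ - 1)) 1
      (κ s i / κ i i * ((√(1 + S * κ i i))⁻¹ - 1)) t i s i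
    simp only [one_mul] at e
    have hsymm : κ i s = κ s i := by
      rw [← hW.covariance_eq, covariance_comm, hW.covariance_eq]
    rw [e, hsymm]
    by_cases hi : κ i i = 0
    · simp [hi, hW.cov_eq_zero_of_var_eq_zero hi]
    set a := (√(1 + S * κ i i))⁻¹ with ha
    have ha2 : a ^ 2 = (1 + S * κ i i)⁻¹ := by rw [ha, inv_pow, Real.sq_sqrt h.le]
    have h3 : κ t s + 1 * (κ s i / κ i i * (a - 1)) * κ t i + κ t i / κ i i * (a - 1) * 1 * κ s i
        + κ t i / κ i i * (a - 1) * (κ s i / κ i i * (a - 1)) * κ i i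
        = κ t s + κ t i * κ s i / κ i i * (a ^ 2 - 1) := by
      field_simp; ring
    have h4 : 1 + S * κ i i ≠ 0 := h.ne'
    refine Eq.trans ?_ (h3.trans ?_)
    · ring
    · rw [ha2]
      obtain ⟨d, hdS⟩ : ∃ d, d = 1 + S * κ i i := ⟨_, rfl⟩
      have hS : S = (d - 1) / κ i i := by rw [hdS]; field_simp; ring
      rw [← hdS] at h4 ⊢
      rw [hS]
      field_simp
      ring

/-- Change of measure by an exponential-quadratic weight in one coordinate of a Gaussian process:
the process with the weight is again Gaussian, with shifted mean and rescaled fluctuations. -/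
theorem lintegral_tilt (hW : IsCenteredGaussian P κ W) (i : ι) {S : ℝ}
    (h : 0 < 1 + S * κ i i) (b : ℝ) (z : ι → ℝ) {F : (ι → ℝ) → ℝ≥0∞} (hF : Measurable F) :
    ∫⁻ ω, F (fun t => z t + W t ω) * ENNReal.ofReal (tiltWeight S b (z i + W i ω)) ∂P =
      ENNReal.ofReal (tiltConst S b (z i) (κ i i)) *
        ∫⁻ ω, F (fun t => (z t + κ t i * ((b - S * z i) / (1 + S * κ i i))) +
          (W t ω + κ t i / κ i i * ((√(1 + S * κ i i))⁻¹ - 1) * W i ω)) ∂P := by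
  have := hW.gaussian.isProbabilityMeasure
  have hWm := hW.measurable
  have hWi := hW.measurable i
  -- Regression residual on coordinate `i`: jointly Gaussian with `W i` and uncorrelated with it,
  -- hence independent, so the weight does not affect it.
  set R : Ω → ι → ℝ := fun ω t => W t ω - κ t i / κ i i * W i ω with hR
  have hRm : Measurable R := by
    refine measurable_pi_lambda _ fun t => ?_
    exact (hWm t).sub (hWi.const_mul _)
  have hind : IndepFun R (W i) P := by
    have hg : IsGaussianProcess
        (Sum.elim (fun t ω => W t ω - κ t i / κ i i * W i ω) (fun _ : Unit => W i)) P := by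
      have := hW.gaussian.linear_combination (Sum.elim id fun _ : Unit => i) (fun _ => i)
        (fun _ => 1) (Sum.elim (fun t => -(κ t i / κ i i)) fun _ => 0)
      convert this using 1
      funext s ω
      rcases s with t | u <;> simp [sub_eq_add_neg]
    have hc := hg.indepFun_of_covariance_eq_zero
      (fun t => ((hWm t).sub (hWi.const_mul _)).aemeasurable) (fun _ => hWi.aemeasurable) ?_
    · exact hc.comp (φ := id) (ψ := fun x : Unit → ℝ => x ()) measurable_id (by fun_prop)
    · intro t _
      have e := hW.covariance_linear_combination 1 (-(κ t i / κ i i)) 1 0 t i i i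
      simp only [one_mul, zero_mul, add_zero, neg_mul, ← sub_eq_add_neg] at e
      rw [e]
      by_cases hi : κ i i = 0
      · simp [hi, hW.cov_eq_zero_of_var_eq_zero hi]
      · field_simp; ring
  set c : ι → ℝ := fun t => z t - κ t i / κ i i * z i with hc
  have hv : ((κ i i).toNNReal : ℝ) = κ i i := Real.coe_toNNReal _ (hW.var_nonneg i)
  have hFm : ∀ r : ι → ℝ, Measurable fun u : ℝ => F (fun t => r t + c t + κ t i / κ i i * u) := by
    intro r
    refine hF.comp (measurable_pi_lambda _ fun t => ?_)
    fun_prop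
  -- With the residual frozen at `r`, only the one-dimensional law of `W i` is tilted.
  have key : ∀ r : ι → ℝ,
      ∫⁻ ω, F (fun t => r t + c t + κ t i / κ i i * (z i + W i ω)) *
          ENNReal.ofReal (tiltWeight S b (z i + W i ω)) ∂P =
      ENNReal.ofReal (tiltConst S b (z i) (κ i i)) *
        ∫⁻ ω, F (fun t => r t + c t + κ t i / κ i i *
          (z i + κ i i * ((b - S * z i) / (1 + S * κ i i)) + W i ω / √(1 + S * κ i i))) ∂P := by
    intro r
    have e := lintegral_tilt_gaussianReal (v := (κ i i).toNNReal) (S := S) (by rwa [hv]) b (z i)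
      (hFm r)
    rw [hv, ← hW.map_eq i, lintegral_map _ hWi, lintegral_map _ hWi] at e
    · exact e
    · exact (hFm r).comp (by fun_prop)
    · have : Measurable fun x => ENNReal.ofReal (tiltWeight S b (z i + x)) := by
        unfold tiltWeight; fun_prop
      exact ((hFm r).comp (by fun_prop)).mul this
  have hunc : Measurable fun p : (ι → ℝ) × ℝ => F (fun t => p.1 t + c t + κ t i / κ i i * p.2) := by
    refine hF.comp (measurable_pi_lambda _ fun t => ?_)
    fun_prop
  have hL := hind.lintegral_comp_prodMk hRm hWi
    (Φ := fun r x => F (fun t => r t + c t + κ t i / κ i i * (z i + x)) *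
          ENNReal.ofReal (tiltWeight S b (z i + x))) (by
      have : Measurable fun p : (ι → ℝ) × ℝ => ENNReal.ofReal (tiltWeight S b (z i + p.2)) := by
        unfold tiltWeight; fun_prop
      exact (hunc.comp (g := fun p => F (fun t => p.1 t + c t + κ t i / κ i i * p.2))
        (f := fun p : (ι → ℝ) × ℝ => (p.1, z i + p.2)) (by fun_prop)).mul this)
  have hRR := hind.lintegral_comp_prodMk hRm hWi
    (Φ := fun r x => F (fun t => r t + c t + κ t i / κ i i *
          (z i + κ i i * ((b - S * z i) / (1 + S * κ i i)) + x / √(1 + S * κ i i)))) (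
      hunc.comp (g := fun p => F (fun t => p.1 t + c t + κ t i / κ i i * p.2))
        (f := fun p : (ι → ℝ) × ℝ => (p.1, z i + κ i i * ((b - S * z i) / (1 + S * κ i i))
          + p.2 / √(1 + S * κ i i))) (by fun_prop))
  simp only [key] at hL
  rw [lintegral_const_mul', ← hRR] at hL
  · convert hL using 3
    · congr 2
      funext t
      simp only [hR, hc]; ring
    · funext ω
      congr 1
      funext t
      simp only [hR, hc]
      have : κ t i / κ i i * (κ i i * ((b - S * z i) / (1 + S * κ i i)))
          = κ t i * ((b - S * z i) / (1 + S * κ i i)) := by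
        by_cases hi : κ i i = 0
        · simp [hi, hW.cov_eq_zero_of_var_eq_zero hi]
        · field_simp
      rw [← this]; ring
  · exact ENNReal.ofReal_ne_top

end IsCenteredGaussian

end GaussianTilt

/-! ### Tilting the coordinates `1, …, n` in succession. -/

section IteratedTilt

/-- The covariance function left after tilting the coordinates `1, …, n` one after the other. -/
noncomputable def condCov (S : ℕ → ℝ) (K : ℕ → ℕ → ℝ) : ℕ → ℕ → ℕ → ℝ
  | 0 => K
  | n + 1 => fun t s => condCov S K n t s - condCov S K n t (n + 1) * condCov S K n s (n + 1) *
      (S (n + 1) / (1 + S (n + 1) * condCov S K n (n + 1) (n + 1)))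

/-- The mean function left after tilting the coordinates `1, …, n` one after the other. -/
noncomputable def condMean (S : ℕ → ℝ) (K : ℕ → ℕ → ℝ) (m b : ℕ → ℝ) : ℕ → ℕ → ℝ
  | 0 => m
  | n + 1 => fun t => condMean S K m b n t + condCov S K n t (n + 1) *
      ((b (n + 1) - S (n + 1) * condMean S K m b n (n + 1)) /
        (1 + S (n + 1) * condCov S K n (n + 1) (n + 1)))

/-- The fluctuations left after tilting the coordinates `1, …, n` one after the other. -/
noncomputable def condProc {Ω : Type*} (S : ℕ → ℝ) (K : ℕ → ℕ → ℝ) (W : ℕ → Ω → ℝ) :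
    ℕ → ℕ → Ω → ℝ
  | 0 => W
  | n + 1 => fun t ω => condProc S K W n t ω +
      condCov S K n t (n + 1) / condCov S K n (n + 1) (n + 1) *
        ((√(1 + S (n + 1) * condCov S K n (n + 1) (n + 1)))⁻¹ - 1) * condProc S K W n (n + 1) ω

/-- The total mass picked up by tilting the coordinates `1, …, n`. -/
noncomputable def tiltMass (S : ℕ → ℝ) (K : ℕ → ℕ → ℝ) (m b : ℕ → ℝ) (n : ℕ) : ℝ :=
  ∏ l ∈ Finset.Icc 1 n,
    tiltConst (S l) (b l) (condMean S K m b (l - 1) l) (condCov S K (l - 1) l l)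

theorem tiltMass_nonneg (S : ℕ → ℝ) (K : ℕ → ℕ → ℝ) (m b : ℕ → ℝ) (n : ℕ) :
    0 ≤ tiltMass S K m b n := Finset.prod_nonneg fun _ _ => tiltConst_nonneg _ _ _ _

/-- The unrolled recursion has the shape of the equation for `γbar`: its `l`-th term involves the
covariance just before coordinate `l` is tilted, so `condCov S K (l - 1) t l` plays the role of
`γbar(t, l)`. -/
theorem condCov_eq_sub_sum (S : ℕ → ℝ) (K : ℕ → ℕ → ℝ) (n t s : ℕ) :
    condCov S K n t s = K t s - ∑ l ∈ Finset.Icc 1 n,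
      condCov S K (l - 1) t l * condCov S K (l - 1) s l *
        (S l / (1 + S l * condCov S K (l - 1) l l)) := by
  induction n with
  | zero => simp [condCov]
  | succ n ih =>
    rw [Finset.sum_Icc_succ_top (by omega), ← sub_sub, ← ih]
    rfl

theorem condMean_eq_add_sum (S : ℕ → ℝ) (K : ℕ → ℕ → ℝ) (m b : ℕ → ℝ) (n t : ℕ) :
    condMean S K m b n t = m t + ∑ l ∈ Finset.Icc 1 n, condCov S K (l - 1) t l *
      ((b l - S l * condMean S K m b (l - 1) l) / (1 + S l * condCov S K (l - 1) l l)) := by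
  induction n with
  | zero => simp [condMean]
  | succ n ih =>
    rw [Finset.sum_Icc_succ_top (by omega), ← add_assoc, ← ih]
    rfl

theorem condMean_congr (S : ℕ → ℝ) (K : ℕ → ℕ → ℝ) (m : ℕ → ℝ) {b b' : ℕ → ℝ} {n : ℕ}
    (h : ∀ l ∈ Finset.Icc 1 n, b l = b' l) (t : ℕ) :
    condMean S K m b n t = condMean S K m b' n t := by
  induction n generalizing t with
  | zero => rfl
  | succ n ih =>
    have ih' := ih fun l hl => h l (Finset.Icc_subset_Icc_right (by omega) hl)
    simp only [condMean, ih', h (n + 1) (by simp)]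

theorem measurable_condMean {α : Type*} [MeasurableSpace α] (S : ℕ → ℝ) (K : ℕ → ℕ → ℝ)
    (m : ℕ → ℝ) {b : α → ℕ → ℝ} {n : ℕ} (hb : ∀ l ∈ Finset.Icc 1 n, Measurable fun y => b y l)
    (t : ℕ) : Measurable fun y => condMean S K m (b y) n t := by
  induction n generalizing t with
  | zero => exact measurable_const
  | succ n ih =>
    have ih' := ih fun l hl => hb l (Finset.Icc_subset_Icc_right (by omega) hl)
    exact (ih' t).add (((hb (n + 1) (by simp)).sub ((ih' _).const_mul _)).div_const _
      |>.const_mul _)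

theorem measurable_tiltConst {α : Type*} [MeasurableSpace α] (S v : ℝ) {b z : α → ℝ}
    (hb : Measurable b) (hz : Measurable z) : Measurable fun y => tiltConst S (b y) (z y) v := by
  unfold tiltConst; fun_prop

theorem measurable_tiltMass {α : Type*} [MeasurableSpace α] (S : ℕ → ℝ) (K : ℕ → ℕ → ℝ)
    (m : ℕ → ℝ) {b : α → ℕ → ℝ} {n : ℕ} (hb : ∀ l ∈ Finset.Icc 1 n, Measurable fun y => b y l) :
    Measurable fun y => tiltMass S K m (b y) n := by
  refine Finset.measurable_prod _ fun l hl => measurable_tiltConst _ _ (hb l hl)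
    (measurable_condMean S K m (fun k hk => hb k ?_) _)
  simp only [Finset.mem_Icc] at hl hk ⊢
  omega

variable {Ω : Type*} {mΩ : MeasurableSpace Ω} {P : Measure Ω} {K : ℕ → ℕ → ℝ} {W : ℕ → Ω → ℝ}

theorem IsCenteredGaussian.condProc (hW : IsCenteredGaussian P K W) {S : ℕ → ℝ} {n : ℕ}
    (hpos : ∀ l ∈ Finset.Icc 1 n, 0 < 1 + S l * condCov S K (l - 1) l l) :
    IsCenteredGaussian P (condCov S K n) (condProc S K W n) := by
  induction n with
  | zero => exact hW
  | succ n ih =>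
    exact (ih fun l hl => hpos l (Finset.Icc_subset_Icc_right (by omega) hl)).rescale (n + 1)
      (hpos (n + 1) (by simp))

theorem measurable_tiltWeight {α : Type*} [MeasurableSpace α] (S : ℝ) {b x : α → ℝ}
    (hb : Measurable b) (hx : Measurable x) : Measurable fun y => tiltWeight S (b y) (x y) := by
  unfold tiltWeight; fun_prop

theorem IsCenteredGaussian.lintegral_prod_tilt (hW : IsCenteredGaussian P K W) {S : ℕ → ℝ} {n : ℕ}
    (hpos : ∀ l ∈ Finset.Icc 1 n, 0 < 1 + S l * condCov S K (l - 1) l l) (m b : ℕ → ℝ)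
    {F : (ℕ → ℝ) → ℝ≥0∞} (hF : Measurable F) :
    ∫⁻ ω, F (fun t => m t + W t ω) *
        ENNReal.ofReal (∏ l ∈ Finset.Icc 1 n, tiltWeight (S l) (b l) (m l + W l ω)) ∂P =
      ENNReal.ofReal (tiltMass S K m b n) *
        ∫⁻ ω, F (fun t => condMean S K m b n t + _root_.condProc S K W n t ω) ∂P := by
  induction n generalizing F with
  | zero => simp [tiltMass, condMean, _root_.condProc]
  | succ n ih =>
    have hpos' : ∀ l ∈ Finset.Icc 1 n, 0 < 1 + S l * condCov S K (l - 1) l l :=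
      fun l hl => hpos l (Finset.Icc_subset_Icc_right (by omega) hl)
    -- The last weight is absorbed into the test function; after `n` tilts it becomes a
    -- one-coordinate weight on the process `condProc S K W n`.
    have hF' : Measurable fun x : ℕ → ℝ =>
        F x * ENNReal.ofReal (tiltWeight (S (n + 1)) (b (n + 1)) (x (n + 1))) :=
      hF.mul (measurable_tiltWeight _ measurable_const (measurable_pi_apply _)).ennreal_ofReal
    have hI := ih hpos' hF'
    have hT := (hW.condProc hpos').lintegral_tilt (n + 1) (hpos (n + 1) (by simp)) (b (n + 1))
      (condMean S K m b n) hF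
    rw [hT, ← mul_assoc, ← ENNReal.ofReal_mul (tiltMass_nonneg _ _ _ _ _)] at hI
    have hm : tiltMass S K m b (n + 1) = tiltMass S K m b n *
        tiltConst (S (n + 1)) (b (n + 1)) (condMean S K m b n (n + 1))
          (condCov S K n (n + 1) (n + 1)) := by
      rw [tiltMass, Finset.prod_Icc_succ_top (by omega)]; rfl
    rw [hm]
    refine Eq.trans (lintegral_congr fun ω => ?_) hI
    rw [Finset.prod_Icc_succ_top (by omega), mul_comm (∏ l ∈ _, _), ENNReal.ofReal_mul,
      ← mul_assoc]
    exact (Real.exp_pos _).le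

end IteratedTilt

/-! ### Replacing the observations by white noise. -/

section Observation

variable {Ω : Type*} {mΩ : MeasurableSpace Ω} {P : Measure Ω}

/-- Keep the coordinates `1, …, n` of a sequence and set the others to `0`. -/
def truncSeq (n : ℕ) (y : ℕ → ℝ) (t : ℕ) : ℝ := if t ∈ Finset.Icc 1 n then y t else 0

theorem truncSeq_of_mem {n t : ℕ} (h : t ∈ Finset.Icc 1 n) (y : ℕ → ℝ) :
    truncSeq n y t = y t := if_pos h

theorem measurable_truncSeq (n : ℕ) : Measurable (truncSeq n) := by
  refine measurable_pi_lambda _ fun t => ?_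
  unfold truncSeq
  split_ifs <;> fun_prop

theorem truncSeq_truncSeq {n k : ℕ} (h : n ≤ k) (y : ℕ → ℝ) :
    truncSeq n (truncSeq k y) = truncSeq n y := by
  funext t
  unfold truncSeq
  simp only [Finset.mem_Icc]
  grind

/-- The covariance function of a standard Gaussian white noise indexed by `t ≥ 1`, extended
by `0` at the index `0`. -/
def noiseCov (t s : ℕ) : ℝ := if t = s ∧ 1 ≤ t then 1 else 0

/-- The classical Cameron–Martin formula for white noise, as the case `S = 0` of the tilt: a purely
exponential weight only moves the mean, and uncorrelatedness confines the move to one coordinate. -/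
theorem IsCenteredGaussian.lintegral_shift {e : ℕ → Ω → ℝ}
    (he : IsCenteredGaussian P noiseCov e) (n : ℕ) (a : ℕ → ℝ) {F : (ℕ → ℝ) → ℝ≥0∞}
    (hF : Measurable F) :
    ∫⁻ ω, F (fun t => truncSeq n a t + e t ω) ∂P = ∫⁻ ω, F (fun t => e t ω) *
      ENNReal.ofReal (∏ l ∈ Finset.Icc 1 n, Real.exp (a l * e l ω - a l ^ 2 / 2)) ∂P := by
  induction n generalizing F with
  | zero => simp [truncSeq]
  | succ n ih =>
    set u : ℕ → ℝ := fun t => if t = n + 1 then a (n + 1) else 0 with hu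
    have hsplit : ∀ t, truncSeq (n + 1) a t = u t + truncSeq n a t := by
      intro t
      simp only [truncSeq, hu, Finset.mem_Icc]
      rcases eq_or_ne t (n + 1) with rfl | ht
      · simp
      · have : t ≤ n + 1 ↔ t ≤ n := by omega
        simp [ht, this]
    have hF' : Measurable fun x : ℕ → ℝ => F (fun t => u t + x t) := by
      refine hF.comp (measurable_pi_lambda _ fun t => ?_)
      fun_prop
    simp only [hsplit, add_assoc]
    rw [ih hF']
    -- The constant `exp (-a² / 2)` is put into `G` to cancel the mass `exp (a² / 2)` produced by
    -- the tilt.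
    set G : (ℕ → ℝ) → ℝ≥0∞ := fun x => F x * ENNReal.ofReal
      (Real.exp (-(a (n + 1) ^ 2 / 2)) *
        ∏ l ∈ Finset.Icc 1 n, Real.exp (a l * x l - a l ^ 2 / 2)) with hG
    have hGm : Measurable G := by
      refine hF.mul (Measurable.ennreal_ofReal ?_)
      fun_prop
    have hT := he.lintegral_tilt (n + 1) (S := 0) (by simp) (a (n + 1)) 0 hGm
    simp only [Pi.zero_apply, zero_mul, sub_zero, add_zero, div_one, zero_add, Real.sqrt_one,
      inv_one, sub_self, mul_zero, noiseCov, ite_mul, one_mul] at hT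
    have hR : ∀ x : ℕ → ℝ, G x * ENNReal.ofReal (tiltWeight 0 (a (n + 1)) (x (n + 1))) = F x *
        ENNReal.ofReal (∏ l ∈ Finset.Icc 1 (n + 1), Real.exp (a l * x l - a l ^ 2 / 2)) := by
      intro x
      simp only [hG]
      rw [mul_assoc, ← ENNReal.ofReal_mul (by positivity), Finset.prod_Icc_succ_top (by omega)]
      congr 2
      rw [mul_right_comm, mul_comm, tiltWeight, ← Real.exp_add]
      congr 2
      ring
    simp only [hR] at hT
    rw [hT, ← lintegral_const_mul' _ _ ENNReal.ofReal_ne_top]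
    refine lintegral_congr fun ω => ?_
    have hx : (fun t => (if t = n + 1 ∧ 1 ≤ t then a (n + 1) else 0) + e t ω)
        = fun t => u t + e t ω := by
      funext t
      simp only [hu]
      congr 1
      refine if_congr ⟨fun h => h.1, fun h => ⟨h, by omega⟩⟩ rfl rfl
    simp only [hG, hx]
    rw [mul_left_comm, ← ENNReal.ofReal_mul (tiltConst_nonneg _ _ _ _), ← mul_assoc]
    congr 2
    have hc : tiltConst 0 (a (n + 1)) 0 (if True ∧ 1 ≤ n + 1 then 1 else 0) *
        Real.exp (-(a (n + 1) ^ 2 / 2)) = 1 := by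
      simp [tiltConst, ← Real.exp_add]
    rw [hc, one_mul]
    refine Finset.prod_congr rfl fun l hl => ?_
    have : l ≠ n + 1 := by
      have := (Finset.mem_Icc.1 hl).2
      omega
    simp [hu, this]

/-- Bayes' formula: under the product law, the observations become white noise and the likelihood
is an exponential-quadratic weight in the signal. -/
theorem lintegral_observation [IsProbabilityMeasure P] {X e Y : ℕ → Ω → ℝ} {A : ℕ → ℝ}
    (hX : ∀ t, Measurable (X t)) (he : IsCenteredGaussian P noiseCov e)
    (hind : IndepFun (fun ω t => X t ω) (fun ω t => e t ω) P)
    (hY : ∀ t, 1 ≤ t → ∀ ω, Y t ω = A t * X t ω + e t ω) (n : ℕ)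
    {F : (ℕ → ℝ) → (ℕ → ℝ) → ℝ≥0∞} (hF : Measurable (Function.uncurry F)) :
    ∫⁻ ω, F (fun t => X t ω) (truncSeq n fun t => Y t ω) ∂P =
      ∫⁻ ω', ∫⁻ ω, F (fun t => X t ω) (truncSeq n fun t => e t ω') * ENNReal.ofReal
        (∏ l ∈ Finset.Icc 1 n, tiltWeight (A l ^ 2) (A l * truncSeq n (fun t => e t ω') l) (X l ω))
          ∂P ∂P := by
  have hXm : Measurable fun ω t => X t ω := measurable_pi_lambda _ hX
  have hem : Measurable fun ω t => e t ω := measurable_pi_lambda _ he.measurable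
  -- Only the first `n` coordinates of the noise need a shift, since the others are truncated away.
  have h1 : ∀ ω, truncSeq n (fun t => Y t ω) =
      truncSeq n (fun t => truncSeq n (fun t => A t * X t ω) t + e t ω) := by
    intro ω
    funext t
    simp only [truncSeq]
    split_ifs with h
    · rw [hY t (Finset.mem_Icc.1 h).1]
    · rfl
  simp only [h1]
  have hmul : Measurable fun x : ℕ → ℝ => fun t => A t * x t :=
    measurable_pi_lambda _ fun t => by fun_prop
  have hΦ : Measurable fun p : (ℕ → ℝ) × (ℕ → ℝ) =>
      F p.1 (truncSeq n fun t => truncSeq n (fun t => A t * p.1 t) t + p.2 t) := by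
    refine hF.comp (measurable_fst.prodMk ((measurable_truncSeq n).comp
      (measurable_pi_lambda _ fun t => ?_)))
    exact ((measurable_pi_apply t).comp ((measurable_truncSeq n).comp
      (hmul.comp measurable_fst))).add ((measurable_pi_apply t).comp measurable_snd)
  rw [hind.lintegral_comp_prodMk hXm hem (Φ := fun x y =>
    F x (truncSeq n fun t => truncSeq n (fun t => A t * x t) t + y t)) hΦ]
  have h2 : ∀ ω, ∫⁻ ω', F (fun t => X t ω)
      (truncSeq n fun t => truncSeq n (fun t => A t * X t ω) t + e t ω') ∂P =
      ∫⁻ ω', F (fun t => X t ω) (truncSeq n fun t => e t ω') * ENNReal.ofReal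
        (∏ l ∈ Finset.Icc 1 n,
          tiltWeight (A l ^ 2) (A l * truncSeq n (fun t => e t ω') l) (X l ω)) ∂P := by
    intro ω
    have hFω : Measurable fun y => F (fun t => X t ω) (truncSeq n y) :=
      hF.comp (measurable_const.prodMk (measurable_truncSeq n))
    rw [he.lintegral_shift n (fun t => A t * X t ω) hFω]
    refine lintegral_congr fun ω' => ?_
    congr 2
    refine Finset.prod_congr rfl fun l hl => ?_
    rw [truncSeq_of_mem hl, tiltWeight]
    congr 1
    ring
  simp only [h2]
  rw [lintegral_lintegral_swap]
  refine Measurable.aemeasurable ?_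
  refine Measurable.mul (hF.comp ((hXm.comp measurable_fst).prodMk
    ((measurable_truncSeq n).comp (hem.comp measurable_snd)))) (Measurable.ennreal_ofReal ?_)
  refine Finset.measurable_prod _ fun l _ => measurable_tiltWeight _ ?_
    ((hX l).comp measurable_fst)
  exact ((measurable_pi_apply l).comp
    ((measurable_truncSeq n).comp (hem.comp measurable_snd))).const_mul _

end Observation

/-! ### Kalman prediction: the tilt with `S = A²`. -/

section Prediction

/-- Through this a `𝒴_n`-measurable variable is a measurable function of one truncated sequence, and
a `𝒴_n`-set is tested by a function `G` of that sequence. -/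
theorem obsSigma_eq_comap {Ω : Type*} (Y : ℕ → Ω → ℝ) (n : ℕ) :
    obsSigma Y n = MeasurableSpace.comap (fun ω => truncSeq n fun t => Y t ω) inferInstance := by
  apply le_antisymm
  · refine iSup₂_le fun u hu => ?_
    have : Y u = (fun y : ℕ → ℝ => y u) ∘ fun ω => truncSeq n fun t => Y t ω := by
      funext ω
      exact (truncSeq_of_mem (Finset.mem_Icc.2 hu) fun t => Y t ω).symm
    rw [this, ← MeasurableSpace.comap_comp]
    exact MeasurableSpace.comap_mono (measurable_pi_apply u).comap_le
  · rw [← measurable_iff_comap_le]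
    refine @measurable_pi_lambda _ _ _ (obsSigma Y n) _ _ fun t => ?_
    unfold truncSeq
    split_ifs with h
    · refine Measurable.of_comap_le ?_
      exact le_iSup₂_of_le (f := fun u (_ : u ∈ Set.Icc 1 n) =>
        MeasurableSpace.comap (Y u) inferInstance) t (Finset.mem_Icc.1 h) le_rfl
    · exact measurable_const

variable {Ω : Type*} [mΩ : MeasurableSpace Ω] {P : Measure Ω}

/-- The setting of the filtering problem for sequences indexed by `ℕ`: the signal is `m + W`, the
noise is `e`, and the observations are `Y`. -/
structure IsFilteringModel (P : Measure Ω) (m : ℕ → ℝ) (K : ℕ → ℕ → ℝ) (A : ℕ → ℝ)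
    (W e Y : ℕ → Ω → ℝ) : Prop where
  signal : IsCenteredGaussian P K W
  noise : IsCenteredGaussian P noiseCov e
  indep : IndepFun (fun ω t => W t ω) (fun ω t => e t ω) P
  observation : ∀ t, 1 ≤ t → ∀ ω, Y t ω = A t * (m t + W t ω) + e t ω

/-- The mean of the signal given the observations `y` up to time `n`. -/
noncomputable def kalmanMean (m : ℕ → ℝ) (K : ℕ → ℕ → ℝ) (A : ℕ → ℝ) (n t : ℕ) (y : ℕ → ℝ) : ℝ :=
  condMean (fun l => A l ^ 2) K m (fun l => A l * y l) n t

/-- The likelihood of the observations `y` up to time `n` with respect to white noise. -/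
noncomputable def kalmanMass (m : ℕ → ℝ) (K : ℕ → ℕ → ℝ) (A : ℕ → ℝ) (n : ℕ) (y : ℕ → ℝ) : ℝ :=
  tiltMass (fun l => A l ^ 2) K m (fun l => A l * y l) n

theorem measurable_kalmanMean (m : ℕ → ℝ) (K : ℕ → ℕ → ℝ) (A : ℕ → ℝ) (n t : ℕ) :
    Measurable (kalmanMean m K A n t) :=
  measurable_condMean _ _ _ (fun l _ => by fun_prop) _

theorem measurable_kalmanMass (m : ℕ → ℝ) (K : ℕ → ℕ → ℝ) (A : ℕ → ℝ) (n : ℕ) :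
    Measurable (kalmanMass m K A n) :=
  measurable_tiltMass _ _ _ fun l _ => by fun_prop

theorem kalmanMean_truncSeq (m : ℕ → ℝ) (K : ℕ → ℕ → ℝ) (A : ℕ → ℝ) {n k : ℕ} (h : n ≤ k) (t : ℕ)
    (y : ℕ → ℝ) : kalmanMean m K A n t (truncSeq k y) = kalmanMean m K A n t y :=
  condMean_congr _ _ _ (fun l hl => by
    rw [truncSeq_of_mem (Finset.Icc_subset_Icc_right h hl)]) _

namespace IsFilteringModel

variable {m : ℕ → ℝ} {K : ℕ → ℕ → ℝ} {A : ℕ → ℝ} {W e Y : ℕ → Ω → ℝ}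

theorem one_add_pos (hF : IsFilteringModel P m K A W e Y) (l : ℕ) :
    0 < 1 + A l ^ 2 * condCov (fun l => A l ^ 2) K (l - 1) l l := by
  -- Positivity at `n + 1` needs a nonnegative variance after `n` tilts, and those tilts need
  -- positivity at all earlier indices; hence the joint induction.
  have key : ∀ n, ∀ l ∈ Finset.Icc 1 n,
      0 < 1 + A l ^ 2 * condCov (fun l => A l ^ 2) K (l - 1) l l := by
    intro n
    induction n with
    | zero => simp
    | succ n ih =>
      intro l hl
      rcases eq_or_ne l (n + 1) with rfl | hne
      · have := (hF.signal.condProc ih).var_nonneg (n + 1)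
        simp only [Nat.add_sub_cancel]
        positivity
      · refine ih l (Finset.mem_Icc.2 ?_)
        have := Finset.mem_Icc.1 hl
        omega
  rcases Nat.eq_zero_or_pos l with rfl | hl
  · have := hF.signal.var_nonneg 0
    change 0 < 1 + A 0 ^ 2 * K 0 0
    positivity
  · exact key l l (by simp; omega)

theorem condProc (hF : IsFilteringModel P m K A W e Y) (n : ℕ) :
    IsCenteredGaussian P (condCov (fun l => A l ^ 2) K n)
      (_root_.condProc (fun l => A l ^ 2) K W n) :=
  hF.signal.condProc fun l _ => hF.one_add_pos l

theorem isProbabilityMeasure (hF : IsFilteringModel P m K A W e Y) : IsProbabilityMeasure P :=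
  hF.signal.gaussian.isProbabilityMeasure

theorem measurable_trunc_noise (hF : IsFilteringModel P m K A W e Y) (n : ℕ) :
    Measurable fun ω => truncSeq n fun t => e t ω :=
  (measurable_truncSeq n).comp (measurable_pi_lambda _ hF.noise.measurable)

theorem measurable_signal (hF : IsFilteringModel P m K A W e Y) (t : ℕ) :
    Measurable fun ω => m t + W t ω := (hF.signal.measurable t).const_add _

theorem measurable_observation (hF : IsFilteringModel P m K A W e Y) {t : ℕ} (ht : 1 ≤ t) :
    Measurable (Y t) := by
  rw [funext (hF.observation t ht)]
  exact ((hF.measurable_signal t).const_mul _).add (hF.noise.measurable t)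

theorem measurable_trunc_obs (hF : IsFilteringModel P m K A W e Y) (n : ℕ) :
    Measurable fun ω => truncSeq n fun t => Y t ω := by
  refine measurable_pi_lambda _ fun t => ?_
  unfold truncSeq
  split_ifs with h
  · exact hF.measurable_observation (Finset.mem_Icc.1 h).1
  · exact measurable_const

theorem lintegral_observation (hF : IsFilteringModel P m K A W e Y) (n : ℕ)
    {F : (ℕ → ℝ) → (ℕ → ℝ) → ℝ≥0∞} (hFm : Measurable (Function.uncurry F)) :
    ∫⁻ ω, F (fun t => m t + W t ω) (truncSeq n fun t => Y t ω) ∂P =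
      ∫⁻ ω', ∫⁻ ω, F (fun t => m t + W t ω) (truncSeq n fun t => e t ω') * ENNReal.ofReal
        (∏ l ∈ Finset.Icc 1 n,
          tiltWeight (A l ^ 2) (A l * truncSeq n (fun t => e t ω') l) (m l + W l ω)) ∂P ∂P := by
  have := hF.isProbabilityMeasure
  refine _root_.lintegral_observation hF.measurable_signal hF.noise ?_ hF.observation n hFm
  have hm : Measurable fun x : ℕ → ℝ => fun t => m t + x t :=
    measurable_pi_lambda _ fun t => by fun_prop
  exact hF.indep.comp hm measurable_id

theorem lintegral_observation_kalman (hF : IsFilteringModel P m K A W e Y) (n : ℕ)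
    {F : (ℕ → ℝ) → (ℕ → ℝ) → ℝ≥0∞} (hFm : Measurable (Function.uncurry F)) :
    ∫⁻ ω, F (fun t => m t + W t ω) (truncSeq n fun t => Y t ω) ∂P =
      ∫⁻ ω', ENNReal.ofReal (kalmanMass m K A n (truncSeq n fun t => e t ω')) *
        ∫⁻ ω, F (fun t => kalmanMean m K A n t (truncSeq n fun t => e t ω') +
          _root_.condProc (fun l => A l ^ 2) K W n t ω) (truncSeq n fun t => e t ω') ∂P ∂P := by
  rw [hF.lintegral_observation n hFm]
  refine lintegral_congr fun ω' => ?_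
  exact hF.signal.lintegral_prod_tilt (fun l _ => hF.one_add_pos l) m
    (fun l => A l * truncSeq n (fun t => e t ω') l)
    (F := fun x => F x (truncSeq n fun t => e t ω')) (hFm.comp
      (measurable_id.prodMk measurable_const))

/-- The observations have the likelihood `kalmanMass` with respect to white noise. -/
theorem lintegral_obs (hF : IsFilteringModel P m K A W e Y) (n : ℕ)
    {G : (ℕ → ℝ) → ℝ≥0∞} (hG : Measurable G) :
    ∫⁻ ω, G (truncSeq n fun t => Y t ω) ∂P =
      ∫⁻ ω, G (truncSeq n fun t => e t ω) *
        ENNReal.ofReal (kalmanMass m K A n (truncSeq n fun t => e t ω)) ∂P := by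
  have := hF.isProbabilityMeasure
  rw [hF.lintegral_observation_kalman n (F := fun _ => G) (hG.comp measurable_snd)]
  refine lintegral_congr fun ω => ?_
  simp [mul_comm]

/-- The prediction error given the observations up to time `n`. -/
noncomputable def residual (m : ℕ → ℝ) (K : ℕ → ℕ → ℝ) (A : ℕ → ℝ) (W Y : ℕ → Ω → ℝ) (n t : ℕ)
    (ω : Ω) : ℝ :=
  m t + W t ω - kalmanMean m K A n t (truncSeq n fun t => Y t ω)

theorem measurable_residual (hF : IsFilteringModel P m K A W e Y) (n t : ℕ) :
    Measurable (residual m K A W Y n t) :=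
  (hF.measurable_signal t).sub ((measurable_kalmanMean m K A n t).comp (hF.measurable_trunc_obs n))

/-- Given the observations, the signal is `kalmanMean` plus a fluctuation `condProc` whose law does
not involve the observed values, so the expectation factorises. Indicators for `Φ` and `G` then
yield the law of the residual and its independence of the past. -/
theorem lintegral_residual_mul (hF : IsFilteringModel P m K A W e Y) (n t : ℕ)
    {Φ : ℝ → ℝ≥0∞} {G : (ℕ → ℝ) → ℝ≥0∞} (hΦ : Measurable Φ) (hG : Measurable G) :
    ∫⁻ ω, Φ (residual m K A W Y n t ω) * G (truncSeq n fun t => Y t ω) ∂P =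
      (∫⁻ ω, Φ (_root_.condProc (fun l => A l ^ 2) K W n t ω) ∂P) *
        ∫⁻ ω, G (truncSeq n fun t => Y t ω) ∂P := by
  have h := hF.lintegral_observation_kalman n
    (F := fun x y => Φ (x t - kalmanMean m K A n t y) * G y) (by
      have := measurable_kalmanMean m K A n t
      exact (hΦ.comp (((measurable_pi_apply t).comp measurable_fst).sub
        (this.comp measurable_snd))).mul (hG.comp measurable_snd))
  refine h.trans ?_
  rw [hF.lintegral_obs n hG, ← lintegral_const_mul]
  · refine lintegral_congr fun ω' => ?_
    simp only [add_sub_cancel_left]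
    have hc : Measurable fun ω => Φ (_root_.condProc (fun l => A l ^ 2) K W n t ω) :=
      hΦ.comp ((hF.condProc n).measurable t)
    rw [lintegral_mul_const _ hc]
    ring
  · exact (hG.comp (hF.measurable_trunc_noise n)).mul
      ((measurable_kalmanMass m K A n).comp (hF.measurable_trunc_noise n)).ennreal_ofReal

theorem map_residual (hF : IsFilteringModel P m K A W e Y) (n t : ℕ) :
    P.map (residual m K A W Y n t) = P.map (_root_.condProc (fun l => A l ^ 2) K W n t) := by
  have := hF.isProbabilityMeasure
  refine Measure.ext fun s hs => ?_
  have h := hF.lintegral_residual_mul n t (Φ := s.indicator 1) (G := 1)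
    (measurable_one.indicator hs) measurable_one
  simp only [Pi.one_apply, mul_one, lintegral_one, measure_univ] at h
  rw [← lintegral_indicator_one hs, ← lintegral_indicator_one hs,
    lintegral_map (measurable_one.indicator hs) (hF.measurable_residual n t),
    lintegral_map (measurable_one.indicator hs) ((hF.condProc n).measurable t), h]

theorem indepFun_residual (hF : IsFilteringModel P m K A W e Y) (n t : ℕ) :
    IndepFun (residual m K A W Y n t) (fun ω => truncSeq n fun t => Y t ω) P := by
  have := hF.isProbabilityMeasure
  have hR := hF.measurable_residual n t
  have hO := hF.measurable_trunc_obs n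
  rw [indepFun_iff_measure_inter_preimage_eq_mul]
  intro s u hs hu
  have h := hF.lintegral_residual_mul n t (Φ := s.indicator 1) (G := u.indicator 1)
    (measurable_one.indicator hs) (measurable_one.indicator hu)
  have h' := hF.lintegral_residual_mul n t (Φ := s.indicator 1) (G := 1)
    (measurable_one.indicator hs) measurable_one
  simp only [Pi.one_apply, mul_one, lintegral_one, measure_univ] at h'
  rw [← h'] at h
  have e1 : ∀ ω, s.indicator (1 : ℝ → ℝ≥0∞) (residual m K A W Y n t ω) =
      (residual m K A W Y n t ⁻¹' s).indicator 1 ω := fun ω => rfl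
  have e2 : ∀ ω, u.indicator (1 : (ℕ → ℝ) → ℝ≥0∞) (truncSeq n fun t => Y t ω) =
      ((fun ω => truncSeq n fun t => Y t ω) ⁻¹' u).indicator 1 ω := fun ω => rfl
  simp only [e1, e2] at h
  rw [lintegral_indicator_one (hR hs), lintegral_indicator_one (hO hu)] at h
  rw [← h, ← lintegral_indicator_one ((hR hs).inter (hO hu)), Set.inter_indicator_one]
  rfl

theorem integrable_residual (hF : IsFilteringModel P m K A W e Y) (n t : ℕ) :
    Integrable (residual m K A W Y n t) P := by
  have h := ((hF.condProc n).gaussian.hasGaussianLaw_eval t).integrable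
  have h2 : Integrable id (P.map (_root_.condProc (fun l => A l ^ 2) K W n t)) :=
    (integrable_map_measure (by fun_prop) ((hF.condProc n).measurable t).aemeasurable).2 h
  rw [← hF.map_residual] at h2
  exact (integrable_map_measure (by fun_prop) (hF.measurable_residual n t).aemeasurable).1 h2

theorem integral_comp_residual (hF : IsFilteringModel P m K A W e Y) (n t : ℕ) {f : ℝ → ℝ}
    (hf : Measurable f) :
    ∫ ω, f (residual m K A W Y n t ω) ∂P =
      ∫ ω, f (_root_.condProc (fun l => A l ^ 2) K W n t ω) ∂P := by
  rw [← integral_map (hF.measurable_residual n t).aemeasurable hf.aestronglyMeasurable,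
    hF.map_residual, integral_map ((hF.condProc n).measurable t).aemeasurable
      hf.aestronglyMeasurable]

/-- The signal is a function of the observations plus a centered residual independent of them. -/
theorem condExp_signal (hF : IsFilteringModel P m K A W e Y) (n t : ℕ) :
    P[fun ω => m t + W t ω | obsSigma Y n] =ᵐ[P]
      fun ω => kalmanMean m K A n t (truncSeq n fun t => Y t ω) := by
  have := hF.isProbabilityMeasure
  have hO := hF.measurable_trunc_obs n
  have hR := hF.measurable_residual n t
  have hle : obsSigma Y n ≤ mΩ := by rw [obsSigma_eq_comap]; exact hO.comap_le
  have hX : Integrable (fun ω => m t + W t ω) P :=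
    (integrable_const _).add (hF.signal.gaussian.hasGaussianLaw_eval t).integrable
  have hRi := hF.integrable_residual n t
  have hk : Integrable (fun ω => kalmanMean m K A n t (truncSeq n fun t => Y t ω)) P := by
    refine (hX.sub hRi).congr (ae_of_all _ fun ω => ?_)
    simp [residual]
  have hsm : StronglyMeasurable[obsSigma Y n]
      fun ω => kalmanMean m K A n t (truncSeq n fun t => Y t ω) := by
    rw [obsSigma_eq_comap]
    exact ((measurable_kalmanMean m K A n t).comp (comap_measurable _)).stronglyMeasurable
  have hsplit : (fun ω => m t + W t ω) = residual m K A W Y n t +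
      fun ω => kalmanMean m K A n t (truncSeq n fun t => Y t ω) := by
    funext ω; simp [residual]
  have hzero : ∫ ω, residual m K A W Y n t ω ∂P = 0 := by
    exact (hF.integral_comp_residual n t measurable_id).trans ((hF.condProc n).integral_eq_zero t)
  have hres : P[residual m K A W Y n t | obsSigma Y n] =ᵐ[P] fun _ => 0 := by
    rw [← hzero]
    refine condExp_indep_eq hR.comap_le hle
      (comap_measurable _).stronglyMeasurable ?_
    rw [obsSigma_eq_comap]
    exact hF.indepFun_residual n t
  rw [hsplit]
  refine (condExp_add hRi hk _).trans ?_
  rw [condExp_of_stronglyMeasurable hle hsm hk]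
  filter_upwards [hres] with ω hω
  simp [hω]

end IsFilteringModel

end Prediction

/-! ### One-step algebra of the factors. -/

section CameronMartinFactors

/-- One factor of the martingale: `z` and `g` are the tilted mean and variance, `p` and `v` the
predicted ones, and `y` is the observation. -/
noncomputable def martFactor (A g v z p y : ℝ) : ℝ :=
  ((1 + A ^ 2 * v) / (1 + A ^ 2 * g)) ^ (1 / 2 : ℝ) *
    Real.exp (A / (1 + A ^ 2 * g) * (z - p) * (y - A * p)
      - 1 / 2 * (A ^ 2 / (1 + A ^ 2 * g)) * (z - p) ^ 2
      - 1 / 2 * (A ^ 2 * (v - g) * (y - A * p) ^ 2 / ((1 + A ^ 2 * g) * (1 + A ^ 2 * v))))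

/-- One factor of the product in front of the martingale in the Cameron-Martin formula. -/
noncomputable def costFactor (A Q μ g h z y : ℝ) : ℝ :=
  ((1 + (A ^ 2 - μ * Q) * g) / (1 + A ^ 2 * g)) ^ (-1 / 2 : ℝ) *
    Real.exp (μ / 2 * Q * ((1 + A ^ 2 * g) / (1 + (A ^ 2 - μ * Q) * g)) *
      (h - (z + A * g * y) / (1 + A ^ 2 * g)) ^ 2)

theorem martFactor_nonneg {g v : ℝ} (hg : 0 ≤ g) (hv : 0 ≤ v) (A z p y : ℝ) :
    0 ≤ martFactor A g v z p y := by
  unfold martFactor; positivity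

theorem costFactor_nonneg {A Q μ g : ℝ} (hg : 0 ≤ g) (hpos : 0 < 1 + (A ^ 2 - μ * Q) * g)
    (h z y : ℝ) : 0 ≤ costFactor A Q μ g h z y := by
  unfold costFactor
  refine mul_nonneg (Real.rpow_nonneg (div_nonneg hpos.le ?_) _) (Real.exp_pos _).le
  positivity

/-- `martFactor` is the ratio at `y` of the densities of `N(A z, 1 + A² g)` and `N(A p, 1 + A² v)`.
-/
theorem martFactor_mul_tiltConst {g v : ℝ} (hg : 0 ≤ g) (hv : 0 ≤ v) (A z p y : ℝ) :
    martFactor A g v z p y * tiltConst (A ^ 2) (A * y) p v = tiltConst (A ^ 2) (A * y) z g := by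
  have hG : 0 < 1 + A ^ 2 * g := by positivity
  have hV : 0 < 1 + A ^ 2 * v := by positivity
  have hGs := (Real.sqrt_pos.2 hG).ne'
  have hVs := (Real.sqrt_pos.2 hV).ne'
  rw [martFactor, tiltConst, tiltConst, ← Real.sqrt_eq_rpow, Real.sqrt_div hV.le, mul_mul_mul_comm,
    ← Real.exp_add]
  congr 1
  · field_simp
  · congr 1
    field_simp
    ring

/-- `costFactor` is the mean of `exp (μ Q (x - h)² / 2)` under the law of a signal `N(z, g)` given
the observation `y`, that is `N((z + A g y) / (1 + A² g), g / (1 + A² g))`. -/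
theorem costFactor_mul_tiltConst {A Q μ g : ℝ} (hg : 0 ≤ g) (hpos : 0 < 1 + (A ^ 2 - μ * Q) * g)
    (h z y : ℝ) :
    costFactor A Q μ g h z y * tiltConst (A ^ 2) (A * y) z g =
      Real.exp (μ / 2 * Q * h ^ 2) * tiltConst (A ^ 2 - μ * Q) (A * y - μ * Q * h) z g := by
  have hG : 0 < 1 + A ^ 2 * g := by positivity
  have hGs := (Real.sqrt_pos.2 hG).ne'
  have hVs := (Real.sqrt_pos.2 hpos).ne'
  rw [costFactor, tiltConst, tiltConst, neg_div, Real.rpow_neg (div_nonneg hpos.le hG.le),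
    ← Real.sqrt_eq_rpow, Real.sqrt_div hpos.le, mul_mul_mul_comm, ← Real.exp_add, mul_left_comm,
    ← Real.exp_add]
  congr 1
  · field_simp
  · congr 1
    obtain ⟨r, hr⟩ : ∃ r, r = μ * Q := ⟨_, rfl⟩
    have h2 : μ / 2 * Q = r / 2 := by rw [hr]; ring
    rw [h2, ← hr]
    rw [← hr] at hpos
    -- The case `g = 0` is separate because `r = μ Q` is eliminated below by dividing by `g`.
    rcases hg.eq_or_lt with rfl | hg'
    · simp; ring
    obtain ⟨d, hd⟩ : ∃ d, d = 1 + (A ^ 2 - r) * g := ⟨_, rfl⟩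
    have hrd : r = A ^ 2 - (d - 1) / g := by rw [hd]; field_simp; ring
    rw [← hd] at hpos ⊢
    rw [hrd]
    field_simp
    ring

/-- The integrand is the density of `N(A z, 1 + A² g)` relative to `N(0,1)`. As a function of `x` it
is again an exponential-quadratic weight, now with a nonpositive `S`, so the one-dimensional tilt
evaluates the integral. -/
theorem lintegral_tiltConst_gaussianReal {g : ℝ} (hg : 0 ≤ g) (A z : ℝ) :
    ∫⁻ x, ENNReal.ofReal (tiltConst (A ^ 2) (A * x) z g) ∂gaussianReal 0 1 = 1 := by
  have hG : 0 < 1 + A ^ 2 * g := by positivity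
  set S : ℝ := -(A ^ 2 * g / (1 + A ^ 2 * g)) with hS
  have h1S : 1 + S * ((1 : NNReal) : ℝ) = (1 + A ^ 2 * g)⁻¹ := by
    rw [hS, NNReal.coe_one]; field_simp; ring
  set b : ℝ := A * z / (1 + A ^ 2 * g) with hb
  set c : ℝ := (√(1 + A ^ 2 * g))⁻¹ * Real.exp (-(A ^ 2 / 2) * z ^ 2 / (1 + A ^ 2 * g)) with hc
  have hw : ∀ x, tiltConst (A ^ 2) (A * x) z g = c * tiltWeight S b x := by
    intro x
    rw [tiltConst, tiltWeight, hc, mul_assoc (√(1 + A ^ 2 * g))⁻¹, ← Real.exp_add]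
    congr 2
    rw [hS, hb]
    field_simp
    ring
  have hc0 : 0 ≤ c := by positivity
  have hpos : 0 < 1 + S * ((1 : NNReal) : ℝ) := by rw [h1S]; positivity
  have h := lintegral_tilt_gaussianReal hpos b 0 (f := fun _ => 1) measurable_const
  simp only [zero_add, one_mul, lintegral_one, measure_univ, mul_one] at h
  simp only [hw, ENNReal.ofReal_mul hc0]
  rw [lintegral_const_mul' _ _ ENNReal.ofReal_ne_top, h, ← ENNReal.ofReal_mul hc0,
    ENNReal.ofReal_eq_one, tiltConst, h1S, hc, Real.sqrt_inv, inv_inv, mul_mul_mul_comm,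
    ← Real.exp_add, inv_mul_cancel₀ (Real.sqrt_pos.2 hG).ne', one_mul, Real.exp_eq_one_iff, hb]
  simp only [NNReal.coe_one]
  field_simp
  ring

end CameronMartinFactors

/-! ### Conditional expectations identified through integrals over sets. -/

section ConditionalExpectation

variable {Ω : Type*} {𝒢 mΩ : MeasurableSpace Ω} {P : Measure Ω}

theorem condLExp_ofReal_of_setLIntegral_eq [IsFiniteMeasure P] (hle : 𝒢 ≤ mΩ) {f g : Ω → ℝ}
    (hg : Measurable[𝒢] g)
    (h : ∀ s, MeasurableSet[𝒢] s →
      ∫⁻ ω in s, ENNReal.ofReal (g ω) ∂P = ∫⁻ ω in s, ENNReal.ofReal (f ω) ∂P) :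
    condLExp 𝒢 P (fun ω => ENNReal.ofReal (f ω)) =ᵐ[P] fun ω => ENNReal.ofReal (g ω) :=
  (ae_eq_condLExp hle P _ hg.ennreal_ofReal h).symm

theorem condExp_of_setLIntegral_eq [IsFiniteMeasure P] (hle : 𝒢 ≤ mΩ) {f g : Ω → ℝ}
    (hf0 : ∀ ω, 0 ≤ f ω) (hg0 : ∀ ω, 0 ≤ g ω) (hg : Measurable[𝒢] g) (hfi : Integrable f P)
    (h : ∀ s, MeasurableSet[𝒢] s →
      ∫⁻ ω in s, ENNReal.ofReal (g ω) ∂P = ∫⁻ ω in s, ENNReal.ofReal (f ω) ∂P) :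
    P[f | 𝒢] =ᵐ[P] g := by
  have h1 := condLExp_ofReal_of_setLIntegral_eq hle hg h
  have hne : ∫⁻ ω, ENNReal.ofReal (f ω) ∂P ≠ ∞ := hfi.lintegral_lt_top.ne
  have h2 := toReal_condLExp 𝒢 hfi.aestronglyMeasurable.aemeasurable.ennreal_ofReal hne
  simp only [ENNReal.toReal_ofReal (hf0 _)] at h2
  filter_upwards [h1, h2] with ω h1 h2
  rw [← h2, h1, ENNReal.toReal_ofReal (hg0 ω)]

end ConditionalExpectation

/-! ### The unnormalised formula and the martingale as functions of the observations. -/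

section CameronMartin

variable {Ω : Type*} [mΩ : MeasurableSpace Ω] {P : Measure Ω}

theorem IsCenteredGaussian.indepFun_truncSeq {e : ℕ → Ω → ℝ}
    (he : IsCenteredGaussian P noiseCov e) (n : ℕ) :
    IndepFun (fun ω => truncSeq n fun t => e t ω) (e (n + 1)) P := by
  have hm : ∀ t, Measurable fun ω => truncSeq n (fun t => e t ω) t := fun t =>
    (measurable_pi_apply t).comp ((measurable_truncSeq n).comp (measurable_pi_lambda _ he.measurable))
  have hlin : ∀ t ω, truncSeq n (fun t => e t ω) t =
      (if t ∈ Finset.Icc 1 n then 1 else 0) * e t ω + 0 * e t ω := by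
    intro t ω
    unfold truncSeq
    split_ifs <;> simp
  have hg : IsGaussianProcess
      (Sum.elim (fun t ω => truncSeq n (fun t => e t ω) t) (fun _ : Unit => e (n + 1))) P := by
    have := he.gaussian.linear_combination (Sum.elim id fun _ : Unit => n + 1)
      (Sum.elim id fun _ : Unit => n + 1)
      (Sum.elim (fun t => if t ∈ Finset.Icc 1 n then 1 else 0) fun _ => 1) (fun _ => 0)
    convert this using 1
    funext s ω
    rcases s with t | u
    · simpa using hlin t ω
    · simp
  have hc := hg.indepFun_of_covariance_eq_zero (fun t => (hm t).aemeasurable)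
    (fun _ => (he.measurable _).aemeasurable) ?_
  · exact hc.comp (φ := id) (ψ := fun x : Unit → ℝ => x ()) measurable_id (by fun_prop)
  · intro t _
    have hc := he.covariance_linear_combination (if t ∈ Finset.Icc 1 n then 1 else 0) 0 1 0 t t
      (n + 1) (n + 1)
    rw [← funext (hlin t)] at hc
    simp only [one_mul, zero_mul, add_zero, mul_zero, mul_one] at hc
    rw [hc]
    split_ifs with h
    · have : t ≠ n + 1 := by
        have := (Finset.mem_Icc.1 h).2
        omega
      simp [noiseCov, this]
    · simp

/-- The mean of the signal at time `t` under the law tilted by the observations and the cost up to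
time `t - 1`, where the control is `h_l = H l y`. -/
noncomputable def tiltedMean (m : ℕ → ℝ) (K : ℕ → ℕ → ℝ) (A Q : ℕ → ℝ) (μ : ℝ)
    (H : ℕ → (ℕ → ℝ) → ℝ) (t : ℕ) (y : ℕ → ℝ) : ℝ :=
  condMean (coefS A Q μ) K m (fun l => A l * y l - μ * Q l * H l (truncSeq l y)) (t - 1) t

theorem measurable_tiltedMean (m : ℕ → ℝ) (K : ℕ → ℕ → ℝ) (A Q : ℕ → ℝ) (μ : ℝ)
    {H : ℕ → (ℕ → ℝ) → ℝ} (hH : ∀ l, Measurable (H l)) (t : ℕ) :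
    Measurable (tiltedMean m K A Q μ H t) := by
  refine measurable_condMean _ _ _ (fun l _ => ?_) _
  have := (hH l).comp (measurable_truncSeq l)
  exact ((measurable_pi_apply l).const_mul _).sub (this.const_mul _)

/-- Predictability: the mean at time `t` uses only the observations before `t`. -/
theorem tiltedMean_truncSeq (m : ℕ → ℝ) (K : ℕ → ℕ → ℝ) (A Q : ℕ → ℝ) (μ : ℝ)
    (H : ℕ → (ℕ → ℝ) → ℝ) {t k : ℕ} (h : t - 1 ≤ k) (y : ℕ → ℝ) :
    tiltedMean m K A Q μ H t (truncSeq k y) = tiltedMean m K A Q μ H t y := by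
  refine condMean_congr _ _ _ (fun l hl => ?_) _
  have hl' := (Finset.mem_Icc.1 hl).2
  rw [truncSeq_of_mem (Finset.Icc_subset_Icc_right h hl), truncSeq_truncSeq (hl'.trans h)]

/-- The tilted likelihood of the observations `y` up to time `n`, with the predictable means `ζ`
and variances `g`. -/
noncomputable def predictableMass (A g : ℕ → ℝ) (ζ : ℕ → (ℕ → ℝ) → ℝ) (n : ℕ) (y : ℕ → ℝ) : ℝ :=
  ∏ r ∈ Finset.Icc 1 n, tiltConst (A r ^ 2) (A r * y r) (ζ r y) (g r)

theorem predictableMass_nonneg (A g : ℕ → ℝ) (ζ : ℕ → (ℕ → ℝ) → ℝ) (n : ℕ) (y : ℕ → ℝ) :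
    0 ≤ predictableMass A g ζ n y := Finset.prod_nonneg fun _ _ => tiltConst_nonneg _ _ _ _

theorem measurable_predictableMass (A g : ℕ → ℝ) {ζ : ℕ → (ℕ → ℝ) → ℝ}
    (hζ : ∀ r, Measurable (ζ r)) (n : ℕ) : Measurable (predictableMass A g ζ n) :=
  Finset.measurable_prod _ fun r _ =>
    measurable_tiltConst _ _ ((measurable_pi_apply r).const_mul _) (hζ r)

theorem predictableMass_succ (A g : ℕ → ℝ) {ζ : ℕ → (ℕ → ℝ) → ℝ}
    (hζ : ∀ r k y, r - 1 ≤ k → ζ r (truncSeq k y) = ζ r y) (n : ℕ) (y : ℕ → ℝ) :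
    predictableMass A g ζ (n + 1) (truncSeq (n + 1) y) = predictableMass A g ζ n (truncSeq n y) *
      tiltConst (A (n + 1) ^ 2) (A (n + 1) * y (n + 1)) (ζ (n + 1) (truncSeq n y)) (g (n + 1)) := by
  rw [predictableMass, Finset.prod_Icc_succ_top (by omega), predictableMass,
    truncSeq_of_mem (by simp), hζ _ _ _ (by omega), hζ _ _ _ (by omega)]
  congr 1
  refine Finset.prod_congr rfl fun r hr => ?_
  have := Finset.mem_Icc.1 hr
  rw [hζ _ _ _ (by omega), hζ _ _ _ (by omega), truncSeq_of_mem hr,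
    truncSeq_of_mem (Finset.Icc_subset_Icc_right (by omega) hr)]

/-- The martingale property under white noise: with the past frozen, the newest factor is a
probability density in `e (n + 1)` and integrates to one. -/
theorem IsCenteredGaussian.lintegral_predictableMass_succ {e : ℕ → Ω → ℝ}
    (he : IsCenteredGaussian P noiseCov e) {A g : ℕ → ℝ} {ζ : ℕ → (ℕ → ℝ) → ℝ}
    (hζm : ∀ r, Measurable (ζ r)) (hζ : ∀ r k y, r - 1 ≤ k → ζ r (truncSeq k y) = ζ r y) {n : ℕ}
    (hg : 0 ≤ g (n + 1)) {G : (ℕ → ℝ) → ℝ≥0∞} (hG : Measurable G) :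
    ∫⁻ ω, G (truncSeq n fun t => e t ω) *
        ENNReal.ofReal (predictableMass A g ζ (n + 1) (truncSeq (n + 1) fun t => e t ω)) ∂P =
      ∫⁻ ω, G (truncSeq n fun t => e t ω) *
        ENNReal.ofReal (predictableMass A g ζ n (truncSeq n fun t => e t ω)) ∂P := by
  have := he.gaussian.isProbabilityMeasure
  have hem := he.measurable (n + 1)
  have htm : Measurable fun ω => truncSeq n fun t => e t ω :=
    (measurable_truncSeq n).comp (measurable_pi_lambda _ he.measurable)
  simp only [predictableMass_succ A g hζ, ENNReal.ofReal_mul (predictableMass_nonneg _ _ _ _ _),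
    ← mul_assoc]
  have hc : Measurable fun p : (ℕ → ℝ) × ℝ => ENNReal.ofReal
      (tiltConst (A (n + 1) ^ 2) (A (n + 1) * p.2) (ζ (n + 1) p.1) (g (n + 1))) :=
    (measurable_tiltConst _ _ (measurable_snd.const_mul _)
      ((hζm _).comp measurable_fst)).ennreal_ofReal
  have hGm : Measurable fun y => G y * ENNReal.ofReal (predictableMass A g ζ n y) :=
    hG.mul (measurable_predictableMass A g hζm n).ennreal_ofReal
  rw [(he.indepFun_truncSeq n).lintegral_comp_prodMk htm hem
    (Φ := fun y x => G y * ENNReal.ofReal (predictableMass A g ζ n y) * ENNReal.ofReal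
      (tiltConst (A (n + 1) ^ 2) (A (n + 1) * x) (ζ (n + 1) y) (g (n + 1))))
    ((hGm.comp measurable_fst).mul hc)]
  refine lintegral_congr fun ω => ?_
  generalize truncSeq n (fun t => e t ω) = y
  have hcy : Measurable fun x : ℝ => ENNReal.ofReal
      (tiltConst (A (n + 1) ^ 2) (A (n + 1) * x) (ζ (n + 1) y) (g (n + 1))) :=
    (measurable_tiltConst _ _ (measurable_id.const_mul _) measurable_const).ennreal_ofReal
  have hmap : P.map (e (n + 1)) = gaussianReal 0 1 := by
    rw [he.map_eq, noiseCov, if_pos ⟨rfl, by omega⟩, Real.toNNReal_one]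
  have hcomp : Measurable fun ω => ENNReal.ofReal
      (tiltConst (A (n + 1) ^ 2) (A (n + 1) * e (n + 1) ω) (ζ (n + 1) y) (g (n + 1))) :=
    hcy.comp hem
  have hone : ∫⁻ ω, ENNReal.ofReal
      (tiltConst (A (n + 1) ^ 2) (A (n + 1) * e (n + 1) ω) (ζ (n + 1) y) (g (n + 1))) ∂P = 1 := by
    rw [← lintegral_map (μ := P) hcy hem, hmap, lintegral_tiltConst_gaussianReal hg]
  rw [lintegral_const_mul _ hcomp, hone, mul_one]

theorem measurable_costFactor {α : Type*} {mα : MeasurableSpace α} (A Q μ g : ℝ) {h z y : α → ℝ}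
    (hh : Measurable h) (hz : Measurable z) (hy : Measurable y) :
    Measurable fun x => costFactor A Q μ g (h x) (z x) (y x) := by
  unfold costFactor; fun_prop

/-- The martingale as a function of the observations `y`. -/
noncomputable def martFun (m : ℕ → ℝ) (K : ℕ → ℕ → ℝ) (A g : ℕ → ℝ) (ζ : ℕ → (ℕ → ℝ) → ℝ) (n : ℕ)
    (y : ℕ → ℝ) : ℝ :=
  ∏ r ∈ Finset.Icc 1 n, martFactor (A r) (g r) (condCov (fun l => A l ^ 2) K (r - 1) r r) (ζ r y)
    (kalmanMean m K A (r - 1) r y) (y r)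

theorem measurable_martFun (m : ℕ → ℝ) (K : ℕ → ℕ → ℝ) (A g : ℕ → ℝ) {ζ : ℕ → (ℕ → ℝ) → ℝ}
    (hζ : ∀ r, Measurable (ζ r)) (n : ℕ) : Measurable (martFun m K A g ζ n) := by
  refine Finset.measurable_prod _ fun r _ => ?_
  have h1 := hζ r
  have h2 := measurable_kalmanMean m K A (r - 1) r
  unfold martFactor
  fun_prop

theorem martFun_truncSeq (m : ℕ → ℝ) (K : ℕ → ℕ → ℝ) (A g : ℕ → ℝ) {ζ : ℕ → (ℕ → ℝ) → ℝ}
    (hζ : ∀ r k y, r - 1 ≤ k → ζ r (truncSeq k y) = ζ r y) {n k : ℕ} (hn : n ≤ k) (y : ℕ → ℝ) :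
    martFun m K A g ζ n (truncSeq k y) = martFun m K A g ζ n y := by
  refine Finset.prod_congr rfl fun r hr => ?_
  have := Finset.mem_Icc.1 hr
  rw [hζ _ _ _ (by omega), kalmanMean_truncSeq _ _ _ (by omega),
    truncSeq_of_mem (Finset.Icc_subset_Icc_right hn hr)]

namespace IsFilteringModel

variable {m : ℕ → ℝ} {K : ℕ → ℕ → ℝ} {A : ℕ → ℝ} {W e Y : ℕ → Ω → ℝ} {g : ℕ → ℝ}
  {ζ : ℕ → (ℕ → ℝ) → ℝ}

theorem kalmanVar_nonneg (hF : IsFilteringModel P m K A W e Y) (n t : ℕ) :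
    0 ≤ condCov (fun l => A l ^ 2) K n t t := (hF.condProc n).var_nonneg t

theorem martFun_nonneg (hF : IsFilteringModel P m K A W e Y) {n : ℕ}
    (hg : ∀ r ∈ Finset.Icc 1 n, 0 ≤ g r) (y : ℕ → ℝ) : 0 ≤ martFun m K A g ζ n y :=
  Finset.prod_nonneg fun r hr => martFactor_nonneg (hg r hr) (hF.kalmanVar_nonneg _ _) _ _ _ _

theorem martFun_mul_kalmanMass (hF : IsFilteringModel P m K A W e Y) {n : ℕ}
    (hg : ∀ r ∈ Finset.Icc 1 n, 0 ≤ g r) (y : ℕ → ℝ) :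
    martFun m K A g ζ n y * kalmanMass m K A n y = predictableMass A g ζ n y := by
  rw [martFun, kalmanMass, tiltMass, predictableMass, ← Finset.prod_mul_distrib]
  exact Finset.prod_congr rfl fun r hr =>
    martFactor_mul_tiltConst (hg r hr) (hF.kalmanVar_nonneg _ _) _ _ _ _

/-- Passing to white noise multiplies by `kalmanMass`, which cancels the denominators of the
martingale factors. -/
theorem lintegral_martFun (hF : IsFilteringModel P m K A W e Y) {n : ℕ}
    (hg : ∀ r ∈ Finset.Icc 1 n, 0 ≤ g r) (hζm : ∀ r, Measurable (ζ r)) {G : (ℕ → ℝ) → ℝ≥0∞}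
    (hG : Measurable G) :
    ∫⁻ ω, G (truncSeq n fun t => Y t ω) *
        ENNReal.ofReal (martFun m K A g ζ n (truncSeq n fun t => Y t ω)) ∂P =
      ∫⁻ ω, G (truncSeq n fun t => e t ω) *
        ENNReal.ofReal (predictableMass A g ζ n (truncSeq n fun t => e t ω)) ∂P := by
  rw [hF.lintegral_obs n (G := fun y => G y * ENNReal.ofReal (martFun m K A g ζ n y))
    (hG.mul (measurable_martFun m K A g hζm n).ennreal_ofReal)]
  refine lintegral_congr fun ω => ?_
  rw [mul_assoc, ← ENNReal.ofReal_mul (hF.martFun_nonneg hg _), hF.martFun_mul_kalmanMass hg]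

theorem lintegral_martFun_succ (hF : IsFilteringModel P m K A W e Y) {n : ℕ}
    (hg : ∀ r ∈ Finset.Icc 1 (n + 1), 0 ≤ g r) (hζm : ∀ r, Measurable (ζ r))
    (hζ : ∀ r k y, r - 1 ≤ k → ζ r (truncSeq k y) = ζ r y) {G : (ℕ → ℝ) → ℝ≥0∞}
    (hG : Measurable G) :
    ∫⁻ ω, G (truncSeq n fun t => Y t ω) *
        ENNReal.ofReal (martFun m K A g ζ (n + 1) (truncSeq (n + 1) fun t => Y t ω)) ∂P =
      ∫⁻ ω, G (truncSeq n fun t => Y t ω) *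
        ENNReal.ofReal (martFun m K A g ζ n (truncSeq n fun t => Y t ω)) ∂P := by
  have h := hF.lintegral_martFun (ζ := ζ) hg hζm (hG.comp (measurable_truncSeq n))
  simp only [Function.comp_apply, truncSeq_truncSeq (Nat.le_succ n)] at h
  rw [h, hF.noise.lintegral_predictableMass_succ hζm hζ (hg _ (by simp)) hG,
    hF.lintegral_martFun (fun r hr => hg r (Finset.Icc_subset_Icc_right (by omega) hr)) hζm hG]

theorem lintegral_martFun_eq_one (hF : IsFilteringModel P m K A W e Y) {n : ℕ}
    (hg : ∀ r ∈ Finset.Icc 1 n, 0 ≤ g r) (hζm : ∀ r, Measurable (ζ r))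
    (hζ : ∀ r k y, r - 1 ≤ k → ζ r (truncSeq k y) = ζ r y) :
    ∫⁻ ω, ENNReal.ofReal (martFun m K A g ζ n (truncSeq n fun t => Y t ω)) ∂P = 1 := by
  have := hF.isProbabilityMeasure
  induction n with
  | zero => simp [martFun]
  | succ n ih =>
    have h := hF.lintegral_martFun_succ hg hζm hζ (G := 1) measurable_one
    simp only [Pi.one_apply, one_mul] at h
    rw [h, ih fun r hr => hg r (Finset.Icc_subset_Icc_right (by omega) hr)]

variable {Q : ℕ → ℝ} {μ : ℝ} {H : ℕ → (ℕ → ℝ) → ℝ} {T : ℕ}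

/-- The unnormalised form of the conditional Cameron-Martin formula. -/
theorem lintegral_expCost (hF : IsFilteringModel P m K A W e Y)
    (hpos : ∀ l ∈ Finset.Icc 1 T,
      0 < 1 + coefS A Q μ l * condCov (coefS A Q μ) K (l - 1) l l)
    (hg : ∀ l ∈ Finset.Icc 1 T, 0 ≤ condCov (coefS A Q μ) K (l - 1) l l)
    (hH : ∀ l, Measurable (H l)) {G : (ℕ → ℝ) → ℝ≥0∞} (hG : Measurable G) :
    ∫⁻ ω, G (truncSeq T fun t => Y t ω) * ENNReal.ofReal (Real.exp (μ / 2 *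
        ∑ s ∈ Finset.Icc 1 T, (m s + W s ω - H s (truncSeq s fun t => Y t ω)) ^ 2 * Q s)) ∂P =
      ∫⁻ ω, G (truncSeq T fun t => Y t ω) * ENNReal.ofReal
        ((∏ t ∈ Finset.Icc 1 T, costFactor (A t) (Q t) μ (condCov (coefS A Q μ) K (t - 1) t t)
            (H t (truncSeq t fun t => Y t ω)) (tiltedMean m K A Q μ H t fun t => Y t ω) (Y t ω)) *
          martFun m K A (fun t => condCov (coefS A Q μ) K (t - 1) t t)
            (tiltedMean m K A Q μ H) T fun t => Y t ω) ∂P := by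
  have := hF.isProbabilityMeasure
  set g : ℕ → ℝ := fun t => condCov (coefS A Q μ) K (t - 1) t t with hgdef
  set ζ := tiltedMean m K A Q μ H with hζdef
  have hζm : ∀ r, Measurable (ζ r) := measurable_tiltedMean m K A Q μ hH
  have hζ : ∀ r k y, r - 1 ≤ k → ζ r (truncSeq k y) = ζ r y :=
    fun r k y h => tiltedMean_truncSeq m K A Q μ H h y
  have hHm : ∀ l, Measurable fun y => H l (truncSeq l y) :=
    fun l => (hH l).comp (measurable_truncSeq l)
  set R : (ℕ → ℝ) → ℝ := fun y => (∏ t ∈ Finset.Icc 1 T,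
    costFactor (A t) (Q t) μ (g t) (H t (truncSeq t y)) (ζ t y) (y t)) * martFun m K A g ζ T y
    with hR
  have hRm : Measurable R := by
    refine (Finset.measurable_prod _ fun t _ => ?_).mul (measurable_martFun m K A g hζm T)
    exact measurable_costFactor _ _ _ _ (hHm t) (hζm t) (measurable_pi_apply t)
  have hRtrunc : ∀ y, R (truncSeq T y) = R y := by
    intro y
    simp only [hR, martFun_truncSeq m K A g hζ le_rfl]
    congr 1
    refine Finset.prod_congr rfl fun t ht => ?_
    have := Finset.mem_Icc.1 ht
    rw [truncSeq_truncSeq this.2, hζ _ _ _ (by omega), truncSeq_of_mem ht]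
  have hcost : ∀ y, 0 ≤ ∏ t ∈ Finset.Icc 1 T,
      costFactor (A t) (Q t) μ (g t) (H t (truncSeq t y)) (ζ t y) (y t) := fun y =>
    Finset.prod_nonneg fun t ht => costFactor_nonneg (hg t ht) (hpos t ht) _ _ _
  set b : (ℕ → ℝ) → ℕ → ℝ := fun y l => A l * y l - μ * Q l * H l (truncSeq l y) with hb
  -- The core identity: the claimed answer times the likelihood is the mass of the combined tilt, up
  -- to the factors `exp (μ Q h² / 2)`.
  have hRmass : ∀ y, R y * kalmanMass m K A T y =
      (∏ l ∈ Finset.Icc 1 T, Real.exp (μ / 2 * Q l * H l (truncSeq l y) ^ 2)) *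
        tiltMass (coefS A Q μ) K m (b y) T := by
    intro y
    rw [hR, mul_assoc, hF.martFun_mul_kalmanMass hg, predictableMass, tiltMass,
      ← Finset.prod_mul_distrib, ← Finset.prod_mul_distrib]
    exact Finset.prod_congr rfl fun l hl =>
      costFactor_mul_tiltConst (hg l hl) (hpos l hl) _ _ _
  have hright := hF.lintegral_obs T (G := fun y => G y * ENNReal.ofReal (R y))
    (hG.mul hRm.ennreal_ofReal)
  simp only [hRtrunc] at hright
  refine Eq.trans ?_ hright.symm
  have hleft := hF.lintegral_observation T (F := fun x y => G y * ENNReal.ofReal (Real.exp (μ / 2 *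
    ∑ s ∈ Finset.Icc 1 T, (x s - H s (truncSeq s y)) ^ 2 * Q s))) (by
      refine (hG.comp measurable_snd).mul (Measurable.ennreal_ofReal
        (Real.measurable_exp.comp (Measurable.const_mul (Finset.measurable_sum _ fun s _ => ?_) _)))
      exact ((((measurable_pi_apply s).comp measurable_fst).sub
        ((hHm s).comp measurable_snd)).pow_const 2).mul_const _)
  refine Eq.trans (lintegral_congr fun ω => ?_) (hleft.trans (lintegral_congr fun ω' => ?_))
  · congr 4
    refine Finset.sum_congr rfl fun s hs => ?_
    rw [truncSeq_truncSeq (Finset.mem_Icc.1 hs).2]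
  · set y := truncSeq T fun t => e t ω' with hy
    have hRy : R (fun t => e t ω') = R y := (hRtrunc _).symm
    rw [hRy, mul_assoc, ← ENNReal.ofReal_mul (mul_nonneg (hcost y) (hF.martFun_nonneg hg y)),
      hRmass, ENNReal.ofReal_mul (Finset.prod_nonneg fun _ _ => (Real.exp_pos _).le)]
    have ht := hF.signal.lintegral_prod_tilt hpos m (b y) (F := fun _ => 1) measurable_const
    simp only [one_mul, lintegral_one, measure_univ, mul_one] at ht
    rw [← ht, ← mul_assoc, ← lintegral_const_mul]
    · refine lintegral_congr fun ω => ?_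
      rw [mul_assoc, mul_assoc, ← ENNReal.ofReal_mul (Real.exp_pos _).le,
        ← ENNReal.ofReal_mul (Finset.prod_nonneg fun _ _ => (Real.exp_pos _).le),
        Finset.mul_sum, Real.exp_sum, ← Finset.prod_mul_distrib, ← Finset.prod_mul_distrib]
      congr 2
      refine Finset.prod_congr rfl fun l _ => ?_
      -- Cost exponent plus likelihood exponent, regrouped by powers of `x_l = m l + W l ω`.
      simp only [tiltWeight, ← Real.exp_add, hb, coefS]
      congr 1
      ring
    · exact (Finset.measurable_prod _ fun l _ => measurable_tiltWeight _ measurable_const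
        (hF.measurable_signal l)).ennreal_ofReal

end IsFilteringModel

end CameronMartin

/-! ### From indices `t ≥ 1` to sequences on all of `ℕ`. -/

section SignalObservationModel

theorem ProbabilityTheory.IsGaussianProcess.add_const {Ω ι : Type*} {mΩ : MeasurableSpace Ω}
    {P : Measure Ω} {X : ι → Ω → ℝ} (hX : IsGaussianProcess X P) (c : ι → ℝ) :
    IsGaussianProcess (fun t ω => X t ω + c t) P where
  hasGaussianLaw I := by
    have h := hX.hasGaussianLaw I
    have hg := h.isGaussian_map
    constructor
    have e : (fun ω => I.restrict fun t => X t ω + c t) =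
        (fun x : I → ℝ => x + I.restrict c) ∘ fun ω => I.restrict (X · ω) := rfl
    rw [e, ← AEMeasurable.map_map_of_aemeasurable (by fun_prop) h.aemeasurable]
    infer_instance

variable {Ω : Type*} [mΩ : MeasurableSpace Ω] {P : Measure Ω} {m : ℕ → ℝ} {K : ℕ → ℕ → ℝ}
  {A : ℕ → ℝ} {X ε Y : ℕ → Ω → ℝ}

/-- The centered signal, extended by `0` at the index `0`. -/
noncomputable def centeredSignal (m : ℕ → ℝ) (X : ℕ → Ω → ℝ) (t : ℕ) (ω : Ω) : ℝ :=
  if 1 ≤ t then X t ω - m t else 0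

theorem signal_eq {Ω : Type*} {m : ℕ → ℝ} {X : ℕ → Ω → ℝ} {t : ℕ} (ht : 1 ≤ t) :
    X t = fun ω => m t + centeredSignal m X t ω := by
  funext ω
  simp [centeredSignal, ht]

/-- The noise, extended by `0` at the index `0`. -/
noncomputable def zeroNoise (ε : ℕ → Ω → ℝ) (t : ℕ) (ω : Ω) : ℝ := if 1 ≤ t then ε t ω else 0

/-- A covariance function on the indices `t ≥ 1`, extended by `0`. -/
noncomputable def zeroCov (K : ℕ → ℕ → ℝ) (t s : ℕ) : ℝ := if 1 ≤ t ∧ 1 ≤ s then K t s else 0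

theorem ProbabilityTheory.IsGaussianProcess.extend_zero {X : ℕ → Ω → ℝ}
    (hX : IsGaussianProcess (fun t : {t : ℕ // 1 ≤ t} => X t) P) :
    IsGaussianProcess (fun t ω => if 1 ≤ t then X t ω else 0) P := by
  -- `max t 1` supplies a legal index at `t = 0`, where the coefficient is zero.
  have h := hX.linear_combination (fun t : ℕ => (⟨max t 1, le_max_right _ _⟩ : {t : ℕ // 1 ≤ t}))
    (fun t : ℕ => (⟨max t 1, le_max_right _ _⟩ : {t : ℕ // 1 ≤ t}))
    (fun t => if 1 ≤ t then 1 else 0) (fun _ => 0)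
  convert h using 1
  funext t ω
  by_cases ht : 1 ≤ t
  · simp [ht]
  · simp [ht]

theorem IsSignalObservationModel.isCenteredGaussian_signal [IsProbabilityMeasure P]
    (hM : IsSignalObservationModel P m K A X ε Y) :
    IsCenteredGaussian P (zeroCov K) (centeredSignal m X) := by
  have hG : IsGaussianProcess (centeredSignal m X) P := by
    have h := (IsGaussianProcess.extend_zero hM.gaussian_signal).add_const
      fun t => if 1 ≤ t then -m t else 0
    convert h using 1
    funext t ω
    unfold centeredSignal
    split_ifs <;> ring
  have h0 : ∀ t, ∫ ω, centeredSignal m X t ω ∂P = 0 := by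
    intro t
    by_cases ht : 1 ≤ t
    · simp only [centeredSignal, ht, if_true]
      rw [integral_sub (hM.gaussian_signal.hasGaussianLaw_eval ⟨t, ht⟩).integrable
        (integrable_const _), hM.mean_signal t ht]
      simp
    · simp [centeredSignal, ht]
  refine ⟨fun t => ?_, hG, h0, fun t s => ?_⟩
  · unfold centeredSignal
    split_ifs with ht
    · exact (hM.measurable_signal t ht).sub_const _
    · exact measurable_const
  · simp only [covariance, h0, sub_zero]
    unfold zeroCov centeredSignal
    by_cases ht : 1 ≤ t
    · by_cases hs : 1 ≤ s
      · simpa [ht, hs] using hM.cov_signal t s ht hs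
      · simp [hs]
    · simp [ht]

theorem IsSignalObservationModel.isCenteredGaussian_noise [IsProbabilityMeasure P]
    (hM : IsSignalObservationModel P m K A X ε Y) :
    IsCenteredGaussian P noiseCov (zeroNoise ε) := by
  have hlaw : ∀ t, 1 ≤ t → HasGaussianLaw (ε t) P := fun t ht => (hM.law_noise t ht).hasGaussianLaw
  have hG : IsGaussianProcess (zeroNoise ε) P := by
    refine IsGaussianProcess.extend_zero ⟨fun I => ?_⟩
    exact (hM.indep_noise.precomp (g := ((↑) : I → {t : ℕ // 1 ≤ t}))
      Subtype.val_injective).hasGaussianLaw fun i => hlaw _ i.1.2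
  have hint : ∀ t, 1 ≤ t → ∫ ω, ε t ω ∂P = 0 := fun t ht => by
    rw [(hM.law_noise t ht).integral_eq, integral_id_gaussianReal]
  refine ⟨fun t => ?_, hG, fun t => ?_, fun t s => ?_⟩
  · unfold zeroNoise
    split_ifs with ht
    · exact hM.measurable_noise t ht
    · exact measurable_const
  · by_cases ht : 1 ≤ t
    · simpa [zeroNoise, ht] using hint t ht
    · simp [zeroNoise, ht]
  · have hz : ∀ t, ¬ 1 ≤ t → zeroNoise ε t = 0 := fun t ht => by
      funext ω; simp [zeroNoise, ht]
    have hp : ∀ t, 1 ≤ t → zeroNoise ε t = ε t := fun t ht => by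
      funext ω; simp [zeroNoise, ht]
    by_cases ht : 1 ≤ t
    swap
    · rw [hz t ht, covariance_zero_left, noiseCov, if_neg (by tauto)]
    by_cases hs : 1 ≤ s
    swap
    · rw [hz s hs, covariance_zero_right, noiseCov, if_neg (by rintro ⟨rfl, h⟩; exact hs h)]
    rw [hp t ht, hp s hs]
    rcases eq_or_ne t s with rfl | hts
    · rw [covariance_self (hM.measurable_noise t ht).aemeasurable, (hM.law_noise t ht).variance_eq,
        variance_id_gaussianReal, noiseCov, if_pos ⟨rfl, ht⟩]
      rfl
    · have hi : IndepFun (ε t) (ε s) P :=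
        hM.indep_noise.indepFun (i := ⟨t, ht⟩) (j := ⟨s, hs⟩) (by simpa using hts)
      rw [hi.covariance_eq_zero (hlaw t ht).memLp_two (hlaw s hs).memLp_two, noiseCov,
        if_neg fun h => hts h.1]

theorem IsSignalObservationModel.isFilteringModel [IsProbabilityMeasure P]
    (hM : IsSignalObservationModel P m K A X ε Y) :
    IsFilteringModel P m (zeroCov K) A (centeredSignal m X) (zeroNoise ε) Y where
  signal := hM.isCenteredGaussian_signal
  noise := hM.isCenteredGaussian_noise
  indep := by
    have h := hM.indep_signal_noise.comp
      (φ := fun (x : {t : ℕ // 1 ≤ t} → ℝ) (t : ℕ) => if h : 1 ≤ t then x ⟨t, h⟩ - m t else 0)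
      (ψ := fun (x : {t : ℕ // 1 ≤ t} → ℝ) (t : ℕ) => if h : 1 ≤ t then x ⟨t, h⟩ else 0)
      (measurable_pi_lambda _ fun t => by split_ifs <;> fun_prop)
      (measurable_pi_lambda _ fun t => by split_ifs <;> fun_prop)
    convert h using 1
    · funext ω t
      simp only [centeredSignal, Function.comp_apply, dite_eq_ite]
    · funext ω t
      simp only [zeroNoise, Function.comp_apply, dite_eq_ite]
  observation t ht ω := by
    simp only [centeredSignal, zeroNoise, ht, if_true, add_sub_cancel]
    exact hM.observation t ht ω

theorem IsSignalObservationModel.predictor_ae_eq [IsProbabilityMeasure P]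
    (hM : IsSignalObservationModel P m K A X ε Y) {t : ℕ} (ht : 1 ≤ t) :
    predictor P X Y t =ᵐ[P] fun ω => kalmanMean m (zeroCov K) A (t - 1) t fun t => Y t ω := by
  have h := hM.isFilteringModel.condExp_signal (t - 1) t
  rw [← signal_eq ht] at h
  simp only [kalmanMean_truncSeq m (zeroCov K) A le_rfl] at h
  exact h

theorem IsSignalObservationModel.predVar_eq [IsProbabilityMeasure P]
    (hM : IsSignalObservationModel P m K A X ε Y) {t : ℕ} (ht : 1 ≤ t) :
    predVar P X Y t = condCov (fun l => A l ^ 2) (zeroCov K) (t - 1) t t := by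
  have hF := hM.isFilteringModel
  have h1 := hF.integral_comp_residual (t - 1) t (f := fun x => x ^ 2) (by fun_prop)
  have h2 := (hF.condProc (t - 1)).covariance_eq t t
  simp only [covariance, (hF.condProc (t - 1)).integral_eq_zero, sub_zero, ← sq] at h2
  rw [← h2, ← h1, predVar]
  refine integral_congr_ae ?_
  filter_upwards [hM.predictor_ae_eq ht] with ω hω
  rw [hω, IsFilteringModel.residual, kalmanMean_truncSeq m (zeroCov K) A le_rfl,
    signal_eq (X := X) (m := m) ht]

end SignalObservationModel

/-! ### Solutions of the two equations are the iterated covariance and mean. -/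

section Equations

variable {Ω : Type*} {m : ℕ → ℝ} {K : ℕ → ℕ → ℝ} {A Q : ℕ → ℝ} {μ : ℝ} {T : ℕ} {g : ℕ → ℕ → ℝ}

/-- The right-hand side at `(t, s)` involves only second indices `l < s`, so strong induction on `s`
determines the solution. -/
theorem IsGammaBarSolution.eq_condCov (hg : IsGammaBarSolution K A Q μ T g) (s t : ℕ) (hs : 1 ≤ s)
    (hst : s ≤ t) (ht : t ≤ T) : g t s = condCov (coefS A Q μ) (zeroCov K) (s - 1) t s := by
  induction s using Nat.strong_induction_on generalizing t with
  | _ s ih =>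
    rw [hg s t hs hst ht, condCov_eq_sub_sum, zeroCov, if_pos ⟨hs.trans hst, hs⟩]
    congr 1
    refine Finset.sum_congr rfl fun l hl => ?_
    obtain ⟨h1, h2⟩ := Finset.mem_Icc.1 hl
    rw [ih l (by omega) t h1 (by omega) ht, ih l (by omega) s h1 (by omega) (by omega),
      ih l (by omega) l h1 le_rfl (by omega)]

/-- The two sums merge since `-μ Q (h - Z) + A (Y - A Z) = (A Y - μ Q h) - S Z`. -/
theorem IsZSolution.eq_tiltedMean {h Y Z : ℕ → Ω → ℝ} (hg : IsGammaBarSolution K A Q μ T g)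
    (hZ : IsZSolution m A Q μ T g h Y Z) {H : ℕ → (ℕ → ℝ) → ℝ}
    (hH : ∀ l, 1 ≤ l → l ≤ T → ∀ ω, h l ω = H l (truncSeq l fun t => Y t ω)) (t : ℕ) (ht : 1 ≤ t)
    (htT : t ≤ T) (ω : Ω) :
    Z t ω = tiltedMean m (zeroCov K) A Q μ H t fun t => Y t ω := by
  induction t using Nat.strong_induction_on with
  | _ t ih =>
    rw [hZ t ht htT ω, tiltedMean, condMean_eq_add_sum, sub_add, ← Finset.sum_sub_distrib,
      sub_eq_add_neg, ← Finset.sum_neg_distrib]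
    congr 1
    refine Finset.sum_congr rfl fun l hl => ?_
    obtain ⟨h1, h2⟩ := Finset.mem_Icc.1 hl
    have e := ih l (by omega) h1 (by omega)
    rw [tiltedMean] at e
    rw [hg.eq_condCov l t h1 (by omega) htT, hg.eq_condCov l l h1 le_rfl (by omega),
      hH l h1 (by omega) ω, ← e]
    simp only [coefS]
    ring

end Equations

/-! ### The main theorem. -/

/-- Conditional Cameron-Martin formula. The conditional expectation `ℐ_T` is that of a positive
random variable (values in `[0, ∞]`), as no integrability is assumed for `μ > 0`; when the variable
is integrable it is the usual one. The martingale is stated on the time interval `{0, …, T}`. -/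
theorem proposition1 {Ω : Type*} [mΩ : MeasurableSpace Ω] (P : Measure Ω) [IsProbabilityMeasure P]
    (m : ℕ → ℝ) (K : ℕ → ℕ → ℝ) (A Q : ℕ → ℝ) (μ : ℝ) (hQ : ∀ t, 1 ≤ t → 0 ≤ Q t)
    (X ε Y : ℕ → Ω → ℝ) (hM : IsSignalObservationModel P m K A X ε Y)
    (T : ℕ) (hT : 1 ≤ T) (hC : ConditionC K A Q μ T)
    (γbar : ℕ → ℕ → ℝ) (hγ : IsGammaBarSolution K A Q μ T γbar)
    (h : ℕ → Ω → ℝ) (hh : ∀ t, 1 ≤ t → t ≤ T → Measurable[obsSigma Y t] (h t))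
    (Z : ℕ → Ω → ℝ) (hZ : IsZSolution m A Q μ T γbar h Y Z) :
    (condLExp (obsSigma Y T) P (fun ω => ENNReal.ofReal (expCost Q μ X h T ω))
      =ᵐ[P] fun ω => ENNReal.ofReal (cmRhs P A Q μ γbar X Y h Z T ω)) ∧
    (Integrable (expCost Q μ X h T) P →
      P[expCost Q μ X h T | obsSigma Y T] =ᵐ[P] cmRhs P A Q μ γbar X Y h Z T) ∧
    Martingale (fun t => cmMartingale P A γbar X Y Z (min t T))
      (obsFiltration Y hM.measurable_obs) P := by
  have hF := hM.isFilteringModel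
  set K' := zeroCov K with hK'
  set g : ℕ → ℝ := fun t => condCov (coefS A Q μ) K' (t - 1) t t with hg
  obtain ⟨g₀, -, huniq, -, hdiag⟩ := hC
  have hγg : ∀ t ∈ Finset.Icc 1 T, γbar t t = g t := fun t ht =>
    hγ.eq_condCov t t (Finset.mem_Icc.1 ht).1 le_rfl (Finset.mem_Icc.1 ht).2
  have hdiag' : ∀ t ∈ Finset.Icc 1 T, 0 ≤ g t ∧ 0 < 1 + coefS A Q μ t * g t := by
    intro t ht
    obtain ⟨h1, h2⟩ := Finset.mem_Icc.1 ht
    rw [← hγg t ht, huniq γbar hγ t t h1 le_rfl h2]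
    exact hdiag t h1 h2
  have hH : ∀ l, ∃ f : (ℕ → ℝ) → ℝ, Measurable f ∧
      (1 ≤ l → l ≤ T → ∀ ω, h l ω = f (truncSeq l fun t => Y t ω)) := by
    intro l
    by_cases hl : 1 ≤ l ∧ l ≤ T
    · have hm := hh l hl.1 hl.2
      rw [obsSigma_eq_comap] at hm
      obtain ⟨f, hf, hfe⟩ := hm.exists_eq_measurable_comp
      exact ⟨f, hf, fun _ _ ω => congrFun hfe ω⟩
    · exact ⟨0, measurable_zero, fun h1 h2 => (hl ⟨h1, h2⟩).elim⟩
  choose H hHm hHe using hH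
  set ζ := tiltedMean m K' A Q μ H with hζdef
  have hζm : ∀ r, Measurable (ζ r) := measurable_tiltedMean m K' A Q μ hHm
  have hζ : ∀ r k y, r - 1 ≤ k → ζ r (truncSeq k y) = ζ r y :=
    fun r k y h => tiltedMean_truncSeq m K' A Q μ H h y
  have hZζ : ∀ t ∈ Finset.Icc 1 T, ∀ ω, Z t ω = ζ t fun t => Y t ω := fun t ht ω =>
    hZ.eq_tiltedMean hγ hHe t (Finset.mem_Icc.1 ht).1 (Finset.mem_Icc.1 ht).2 ω
  have hle : ∀ n, obsSigma Y n ≤ mΩ := (obsFiltration Y hM.measurable_obs).le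
  have hYm : ∀ t n, t ∈ Finset.Icc 1 n → Measurable[obsSigma Y n] (Y t) := fun t n ht =>
    Measurable.of_comap_le (le_iSup₂_of_le (f := fun u (_ : u ∈ Set.Icc 1 n) =>
      MeasurableSpace.comap (Y u) inferInstance) t (Finset.mem_Icc.1 ht) le_rfl)
  have htr : ∀ n, Measurable[obsSigma Y n] fun ω => truncSeq n fun t => Y t ω := fun n => by
    rw [obsSigma_eq_comap]; exact comap_measurable _
  have hmart_ae : ∀ n ≤ T, cmMartingale P A γbar X Y Z n =ᵐ[P]
      fun ω => martFun m K' A g ζ n fun t => Y t ω := by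
    intro n hn
    have hp : ∀ᵐ ω ∂P, ∀ t ∈ Finset.Icc 1 n,
        predictor P X Y t ω = kalmanMean m K' A (t - 1) t fun t => Y t ω :=
      (Finset.eventually_all _).2 fun t ht => hM.predictor_ae_eq (Finset.mem_Icc.1 ht).1
    filter_upwards [hp] with ω hω
    refine Finset.prod_congr rfl fun t ht => ?_
    have htT : t ∈ Finset.Icc 1 T := Finset.Icc_subset_Icc_right hn ht
    simp only [innovation]
    rw [hω t ht, hZζ t htT, hγg t htT, hM.predVar_eq (Finset.mem_Icc.1 ht).1]
    rfl
  have hmart_nonneg : ∀ n ≤ T, ∀ ω, 0 ≤ martFun m K' A g ζ n fun t => Y t ω := fun n hn ω =>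
    hF.martFun_nonneg (fun r hr => (hdiag' r (Finset.Icc_subset_Icc_right hn hr)).1) _
  have hmart_meas : ∀ n, Measurable[obsSigma Y n] fun ω => martFun m K' A g ζ n fun t => Y t ω := by
    intro n
    have := (measurable_martFun m K' A g hζm n).comp (htr n)
    simpa only [Function.comp_def, martFun_truncSeq m K' A g hζ le_rfl] using this
  -- Test functions of the truncated observations include the indicators of all `𝒴_n`-sets.
  have hset : ∀ n (f₁ f₂ : Ω → ℝ), (∀ G : (ℕ → ℝ) → ℝ≥0∞, Measurable G →
      ∫⁻ ω, G (truncSeq n fun t => Y t ω) * ENNReal.ofReal (f₁ ω) ∂P =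
        ∫⁻ ω, G (truncSeq n fun t => Y t ω) * ENNReal.ofReal (f₂ ω) ∂P) →
      ∀ s, MeasurableSet[obsSigma Y n] s →
        ∫⁻ ω in s, ENNReal.ofReal (f₁ ω) ∂P = ∫⁻ ω in s, ENNReal.ofReal (f₂ ω) ∂P := by
    intro n f₁ f₂ hf s hs
    have hs' := hle n s hs
    rw [obsSigma_eq_comap] at hs
    obtain ⟨u, hu, rfl⟩ := hs
    have hG := hf (u.indicator 1) (measurable_one.indicator hu)
    rw [← lintegral_indicator hs', ← lintegral_indicator hs']
    convert hG using 3 with ω ω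
    · by_cases hω : (truncSeq n fun t => Y t ω) ∈ u <;> simp [Set.indicator, hω]
    · by_cases hω : (truncSeq n fun t => Y t ω) ∈ u <;> simp [Set.indicator, hω]
  set R : Ω → ℝ := fun ω => (∏ t ∈ Finset.Icc 1 T, costFactor (A t) (Q t) μ (g t)
    (H t (truncSeq t fun t => Y t ω)) (ζ t fun t => Y t ω) (Y t ω)) *
      martFun m K' A g ζ T fun t => Y t ω with hR
  have hR_ae : cmRhs P A Q μ γbar X Y h Z T =ᵐ[P] R := by
    filter_upwards [hmart_ae T le_rfl] with ω hω
    rw [cmRhs, hω, hR]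
    congr 1
    refine Finset.prod_congr rfl fun t ht => ?_
    obtain ⟨h1, h2⟩ := Finset.mem_Icc.1 ht
    rw [hγg t ht, hZζ t ht, hHe t h1 h2]
    rfl
  have hR_nonneg : ∀ ω, 0 ≤ R ω := fun ω => mul_nonneg (Finset.prod_nonneg fun t ht =>
    costFactor_nonneg (hdiag' t ht).1 (hdiag' t ht).2 _ _ _) (hmart_nonneg T le_rfl ω)
  have hR_meas : Measurable[obsSigma Y T] R := by
    refine Measurable.mul (Finset.measurable_prod _ fun t ht => ?_) (hmart_meas T)
    obtain ⟨h1, h2⟩ := Finset.mem_Icc.1 ht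
    refine measurable_costFactor _ _ _ _ ?_ ?_ (hYm t T ht)
    · have := ((hHm t).comp (measurable_truncSeq t)).comp (htr T)
      simpa only [Function.comp_def, truncSeq_truncSeq h2] using this
    · have := (hζm t).comp (htr T)
      simpa only [Function.comp_def, hζ t T _ (by omega)] using this
  have hcost : expCost Q μ X h T = fun ω => Real.exp (μ / 2 * ∑ s ∈ Finset.Icc 1 T,
      (m s + centeredSignal m X s ω - H s (truncSeq s fun t => Y t ω)) ^ 2 * Q s) := by
    funext ω
    rw [expCost]
    congr 2
    refine Finset.sum_congr rfl fun s hs => ?_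
    obtain ⟨h1, h2⟩ := Finset.mem_Icc.1 hs
    rw [hHe s h1 h2, signal_eq (X := X) (m := m) h1]
  have hmain : ∀ s, MeasurableSet[obsSigma Y T] s → ∫⁻ ω in s, ENNReal.ofReal (R ω) ∂P =
      ∫⁻ ω in s, ENNReal.ofReal (expCost Q μ X h T ω) ∂P := by
    refine hset T _ _ fun G hG => ?_
    rw [hcost]
    exact (hF.lintegral_expCost (fun l hl => (hdiag' l hl).2) (fun l hl => (hdiag' l hl).1)
      hHm hG).symm
  refine ⟨?_, fun hint => ?_, ?_⟩
  · filter_upwards [condLExp_ofReal_of_setLIntegral_eq (hle T) hR_meas hmain, hR_ae] with ω h1 h2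
    rw [h1, h2]
  · exact (condExp_of_setLIntegral_eq (hle T) (fun ω => (Real.exp_pos _).le) hR_nonneg hR_meas hint
      hmain).trans hR_ae.symm
  have hint : ∀ n ≤ T, Integrable (fun ω => martFun m K' A g ζ n fun t => Y t ω) P := by
    intro n hn
    refine ⟨((hmart_meas n).mono (hle n) le_rfl).aestronglyMeasurable, ?_⟩
    rw [hasFiniteIntegral_iff_ofReal (ae_of_all _ (hmart_nonneg n hn))]
    have h1 := hF.lintegral_martFun_eq_one (n := n)
      (fun r hr => (hdiag' r (Finset.Icc_subset_Icc_right hn hr)).1) hζm hζ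
    simp only [martFun_truncSeq m K' A g hζ le_rfl] at h1
    rw [h1]
    exact ENNReal.one_lt_top
  -- The filtration is not completed, so almost sure equality with `martFun` would not give
  -- adaptedness; it comes from the exact measurability of `predictor`.
  have hadapt : ∀ n ≤ T, Measurable[obsSigma Y n] (cmMartingale P A γbar X Y Z n) := by
    intro n hn
    refine Finset.measurable_prod _ fun t ht => ?_
    obtain ⟨h1, h2⟩ := Finset.mem_Icc.1 ht
    have hpm : Measurable[obsSigma Y n] (predictor P X Y t) :=
      stronglyMeasurable_condExp.measurable.mono
        ((obsFiltration Y hM.measurable_obs).mono (by omega : t - 1 ≤ n)) le_rfl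
    have hZm : Measurable[obsSigma Y n] (Z t) := by
      rw [funext (hZζ t (Finset.Icc_subset_Icc_right hn ht))]
      have := (hζm t).comp (htr n)
      simpa only [Function.comp_def, hζ t n _ (by omega)] using this
    have hYt := hYm t n ht
    unfold innovation
    fun_prop
  refine martingale_nat (fun i => ?_) (fun i => ?_) fun i => ?_
  · exact ((hadapt (min i T) (min_le_right _ _)).mono
      ((obsFiltration Y hM.measurable_obs).mono (min_le_left _ _)) le_rfl).stronglyMeasurable
  · exact (hint _ (min_le_right _ _)).congr (hmart_ae _ (min_le_right _ _)).symm
  · rcases lt_or_ge i T with hi | hi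
    · rw [min_eq_left hi.le, min_eq_left (Nat.succ_le_of_lt hi)]
      have hstep := condExp_of_setLIntegral_eq (hle i) (hmart_nonneg (i + 1) hi)
        (hmart_nonneg i hi.le) (hmart_meas i) (hint (i + 1) hi) (hset i _ _ fun G hG => by
          have h1 := hF.lintegral_martFun_succ (n := i) (g := g) (ζ := ζ)
            (fun r hr => (hdiag' r (Finset.Icc_subset_Icc_right hi hr)).1) hζm hζ hG
          simp only [martFun_truncSeq m K' A g hζ le_rfl] at h1
          exact h1.symm)
      exact (hmart_ae i hi.le).trans (hstep.symm.trans
        (condExp_congr_ae (hmart_ae (i + 1) hi).symm))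
    -- From time `T` on the process is frozen at a `𝒴_T`-measurable variable.
    · rw [min_eq_right hi, min_eq_right (by omega : T ≤ i + 1)]
      have hsm : StronglyMeasurable[obsSigma Y i] (cmMartingale P A γbar X Y Z T) :=
        ((hadapt T le_rfl).mono ((obsFiltration Y hM.measurable_obs).mono hi)
          le_rfl).stronglyMeasurable
      exact (condExp_of_stronglyMeasurable (hle i) hsm
        ((hint T le_rfl).congr (hmart_ae T le_rfl).symm)).symm.eventuallyEq
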